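/- **Reflection calculus and worms.** For an ordinal $\Lambda$, let $\mathbb F_\Lambda$ be the set of formulas built from $\top$ and propositional variables by $\wedge$ and modalities $\langle\alpha\rangle$, $\alpha<\Lambda$. The calculus $\mathbf{RC}_\Lambda$ derives sequents $\varphi\vdash\psi$ between such formulas from the axioms $\varphi\vdash\varphi$; $\varphi\vdash\top$; $\varphi\wedge\psi\vdash\varphi$; $\varphi\wedge\psi\vdash\psi$; $\langle\alpha\rangle\langle\alpha\rangle\varphi\vdash\langle\alpha\rangle\varphi$; and, for $\alpha>\beta$, $\langle\alpha\rangle\varphi\vdash\langle\beta\rangle\varphi$ and $\langle\alpha\rangle\varphi\wedge\langle\beta\rangle\psi\vdash\langle\alpha\rangle(\varphi\wedge\langle\beta\rangle\psi)$; by the rules: from $\varphi\vdash\psi$ and $\varphi\vdash\chi$ infer $\varphi\vdash\psi\wedge\chi$; from $\varphi\vdash\psi$ and $\psi\vdash\chi$ infer $\varphi\vdash\chi$; from $\varphi\vdash\psi$ infer $\langle\alpha\rangle\varphi\vdash\langle\alpha\rangle\psi$. Let $\Gamma_0$ be the Feferman–Schütte ordinal, and write $\vdash$ for derivability in $\mathbf{RC}_{\Gamma_0}$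 and $A\equiv B$ for $A\vdash B$ and $B\vdash A$. A *worm* is a formula $\langle\xi_1\rangle\cdots\langle\xi_n\rangle\top$ with all $\xi_i<\Gamma_0$; juxtaposition of worms denotes concatenation. For worms put $B<_\mu A$ if $A\vdash\langle\mu\rangle B$, and $B\le_\mu A$ if $B<_\mu A$ or $A\equiv B$. The relation $<_0$ is well-founded, and $o(A)=\sup_{B<_0A}(o(B)+1)$ is the order-type of $A$. A worm is in *Beklemishev normal form* ($\mathsf{BNF}$) if it is $\top$, or it is of the form $A_k\langle\alpha\rangle A_{k-1}\langle\alpha\rangle\cdots\langle\alpha\rangle A_0$ with $k\ge1$, where every modality occurring in the $A_i$ is $\ge\alpha+1$, each $A_i$ is in $\mathsf{BNF}$, and $A_{i+1}\le_{\alpha+1}A_i$ for all $i<k$. **Brackets.** Bracket worms are generated by: $\top$ is a bracket worm, and $(a)b$ is one whenever $a$ and $b$ are; write $()b$ for $(\top)b$. Put $\top^*=\top$, $\big((a)b\big)^*=\langle o(a^*)\rangle b^*$ and $o^*(a)=o(a^*)$. Let $\mathsf{NF}$ be the least set of bracket worms that contains $\top$ and contains $(a)b$ whenever $a,b\in\mathsf{NF}$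 and $\big((a)b\big)^*\in\mathsf{BNF}$. **Bracket calculus.** Formulas of $\mathbf{BC}$ are built from $\top$ and propositional variables by $\wedge$ and modalities $(a)$, $a$ a bracket worm. For bracket worms, $b\lhd a$ means that $a\vdash_{\mathbf{BC}}()b$, and $b\unlhd a$ means that $a\vdash_{\mathbf{BC}}()b$ or $a\vdash_{\mathbf{BC}}b$. The axioms of $\mathbf{BC}$ are $\varphi\vdash\varphi$; $\varphi\vdash\top$; $\varphi\wedge\psi\vdash\varphi$; $\varphi\wedge\psi\vdash\psi$. Its rules are: from $\varphi\vdash\psi$ and $\varphi\vdash\chi$ infer $\varphi\vdash\psi\wedge\chi$; from $\varphi\vdash\psi$ and $\psi\vdash\chi$ infer $\varphi\vdash\chi$; from $\varphi\vdash\psi$ and $b\unlhd a$ infer $(a)\varphi\vdash(b)\psi$ and $(a)(b)\varphi\vdash(b)\psi$; from $b\lhd a$ infer $(a)\varphi\wedge(b)\psi\vdash(a)(\varphi\wedge(b)\psi)$. **Theorem.** The relation $\unlhd$ is a linear well-order on $\mathsf{NF}$ (a reflexive, transitive, total, antisymmetric relation for which every non-empty subset of $\mathsf{NF}$ has a least element),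 and its order type is $\Gamma_0$. Moreover $(\mathsf{NF},\unlhd)$ is a notation system for $\Gamma_0$: the map $o^*$ restricts to a bijection from $\mathsf{NF}$ onto the set of ordinals below $\Gamma_0$, and for all $a,b\in\mathsf{NF}$, $a\unlhd b$ if and only if $o^*(a)\le o^*(b)$. -/

import Mathlib

open scoped Ordinal

namespace BracketCalculus

/-! ### The reflection calculus -/

/-- Strictly positive formulas with modalities `⟨α⟩`, where `α` ranges over all ordinals and the
propositional variables are indexed by `ℕ`. -/
inductive RCForm : Type 1
  | top : RCForm
  | var : ℕ → RCForm
  | and : RCForm → RCForm → RCForm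
  | dia : Ordinal.{0} → RCForm → RCForm

/-- `φ.InF Λ` says that `φ` belongs to `𝔽_Λ`: all modalities of `φ` are below `Λ`. -/
def RCForm.InF (Λ : Ordinal.{0}) : RCForm → Prop
  | .top => True
  | .var _ => True
  | .and φ ψ => φ.InF Λ ∧ ψ.InF Λ
  | .dia α φ => α < Λ ∧ φ.InF Λ

/-- `RC Λ φ ψ` is derivability of the sequent `φ ⊢ ψ` in the reflection calculus `RC_Λ`.
The side conditions say that all formulas in a derivation belong to `𝔽_Λ`. -/
inductive RC (Λ : Ordinal.{0}) : RCForm → RCForm → Prop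
  | refl (φ : RCForm) : φ.InF Λ → RC Λ φ φ
  | top (φ : RCForm) : φ.InF Λ → RC Λ φ .top
  | and_left (φ ψ : RCForm) : φ.InF Λ → ψ.InF Λ → RC Λ (.and φ ψ) φ
  | and_right (φ ψ : RCForm) : φ.InF Λ → ψ.InF Λ → RC Λ (.and φ ψ) ψ
  | dia_dia (α : Ordinal.{0}) (φ : RCForm) : α < Λ → φ.InF Λ →
      RC Λ (.dia α (.dia α φ)) (.dia α φ)
  | dia_mono (α β : Ordinal.{0}) (φ : RCForm) : α < Λ → β < α → φ.InF Λ →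
      RC Λ (.dia α φ) (.dia β φ)
  | dia_and (α β : Ordinal.{0}) (φ ψ : RCForm) : α < Λ → β < α → φ.InF Λ → ψ.InF Λ →
      RC Λ (.and (.dia α φ) (.dia β ψ)) (.dia α (.and φ (.dia β ψ)))
  | and_intro {φ ψ χ : RCForm} : RC Λ φ ψ → RC Λ φ χ → RC Λ φ (.and ψ χ)
  | cut {φ ψ χ : RCForm} : RC Λ φ ψ → RC Λ ψ χ → RC Λ φ χ
  | nec (α : Ordinal.{0}) {φ ψ : RCForm} : α < Λ → RC Λ φ ψ → RC Λ (.dia α φ) (.dia α ψ)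

/-! ### Worms and the consistency ordering -/

/-- The list `[ξ₁, …, ξₙ]` stands for the worm `⟨ξ₁⟩ … ⟨ξₙ⟩ ⊤`. -/
abbrev Worm : Type 1 := List Ordinal.{0}

/-- The formula `⟨ξ₁⟩ … ⟨ξₙ⟩ ⊤`. -/
def Worm.toForm : Worm → RCForm
  | [] => .top
  | α :: A => .dia α (Worm.toForm A)

/-- `wlt Λ μ B A` is `B <_μ A`, that is, `A ⊢ ⟨μ⟩ B` in `RC_Λ`. -/
def wlt (Λ μ : Ordinal.{0}) (B A : Worm) : Prop :=
  RC Λ (Worm.toForm A) (.dia μ (Worm.toForm B))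

/-- `wle Λ μ B A` is `B ≤_μ A`, that is, `B <_μ A` or `B` and `A` are equivalent in `RC_Λ`. -/
def wle (Λ μ : Ordinal.{0}) (B A : Worm) : Prop :=
  wlt Λ μ B A ∨
    (RC Λ (Worm.toForm B) (Worm.toForm A) ∧ RC Λ (Worm.toForm A) (Worm.toForm B))

open Classical in
/-- The order-type `o(A) = sup {o(B) + 1 | B <₀ A}` of a worm `A` in the worms of `RC_Λ`.
Worms that are not in `𝔽_Λ` are not related to anything by `wlt Λ 0`, so they do not contribute;
the worms that contribute to the supremum form a small set, so it is a supremum of a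
bounded set. The recursion is along `<₀`; the value in the `else` branch is never used, as `<₀`
is well-founded. -/
noncomputable def wormO (Λ : Ordinal.{0}) (A : Worm) : Ordinal.{0} :=
  if h : WellFounded (wlt Λ 0) then
    h.fix (C := fun _ => Ordinal.{0}) (fun A o => ⨆ B : {B : Worm // wlt Λ 0 B A}, (o B.1 B.2 + 1)) A
  else 0

/-- `joinBlocks α A k` is the worm `A_k ⟨α⟩ A_{k-1} ⟨α⟩ … ⟨α⟩ A_0`. -/
def joinBlocks (α : Ordinal.{0}) (A : ℕ → Worm) : ℕ → Worm
  | 0 => A 0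
  | k + 1 => A (k + 1) ++ α :: joinBlocks α A k

/-- Beklemishev normal forms among the worms of `RC_Λ`: the worm `⊤`, and the worms
`A_k ⟨α⟩ … ⟨α⟩ A_0` with `k ≥ 1`, where all modalities of the `A_i` are at least `α + 1`
(so `α` is the least modality of the whole worm), each `A_i` is in normal form, and
`A_{i+1} ≤_{α+1} A_i` for `i < k`. -/
inductive BNF (Λ : Ordinal.{0}) : Worm → Prop
  | top : BNF Λ []
  | blocks (α : Ordinal.{0}) (A : ℕ → Worm) (k : ℕ) : α < Λ → 1 ≤ k →
      (∀ i ≤ k, ∀ β ∈ A i, α + 1 ≤ β) →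
      (∀ i ≤ k, BNF Λ (A i)) →
      (∀ i < k, wle Λ (α + 1) (A (i + 1)) (A i)) →
      BNF Λ (joinBlocks α A k)

/-! ### Bracket worms and the bracket calculus -/

/-- The bracket worms: `⊤`, and `(a) b` for bracket worms `a` and `b`. -/
inductive BWorm : Type
  | top : BWorm
  | br : BWorm → BWorm → BWorm

/-- Formulas of the bracket calculus. -/
inductive BForm : Type
  | top : BForm
  | var : ℕ → BForm
  | and : BForm → BForm → BForm
  | br : BWorm → BForm → BForm

/-- A bracket worm as a formula of the bracket calculus. -/
def BWorm.toForm : BWorm → BForm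
  | .top => .top
  | .br a b => .br a b.toForm

/-- `BC φ ψ` is derivability of the sequent `φ ⊢ ψ` in the bracket calculus.
The rules with premise `b ⊴ a` (that is, `a ⊢ () b` or `a ⊢ b`) are each split into two,
with suffix `_lt` for the premise `a ⊢ () b` and suffix `_imp` for the premise `a ⊢ b`. -/
inductive BC : BForm → BForm → Prop
  | refl (φ : BForm) : BC φ φ
  | top (φ : BForm) : BC φ .top
  | and_left (φ ψ : BForm) : BC (.and φ ψ) φ
  | and_right (φ ψ : BForm) : BC (.and φ ψ) ψ
  | and_intro {φ ψ χ : BForm} : BC φ ψ → BC φ χ → BC φ (.and ψ χ)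
  | cut {φ ψ χ : BForm} : BC φ ψ → BC ψ χ → BC φ χ
  | br_lt {φ ψ : BForm} {a b : BWorm} : BC φ ψ → BC a.toForm (.br .top b.toForm) →
      BC (.br a φ) (.br b ψ)
  | br_imp {φ ψ : BForm} {a b : BWorm} : BC φ ψ → BC a.toForm b.toForm →
      BC (.br a φ) (.br b ψ)
  | br_br_lt {φ ψ : BForm} {a b : BWorm} : BC φ ψ → BC a.toForm (.br .top b.toForm) →
      BC (.br a (.br b φ)) (.br b ψ)
  | br_br_imp {φ ψ : BForm} {a b : BWorm} : BC φ ψ → BC a.toForm b.toForm →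
      BC (.br a (.br b φ)) (.br b ψ)
  | br_and (φ ψ : BForm) {a b : BWorm} : BC a.toForm (.br .top b.toForm) →
      BC (.and (.br a φ) (.br b ψ)) (.br a (.and φ (.br b ψ)))

/-- `BWorm.le b a` is `b ⊴ a`: one of `a ⊢ () b` and `a ⊢ b` is derivable in the bracket
calculus. -/
def BWorm.le (b a : BWorm) : Prop :=
  BC a.toForm (.br .top b.toForm) ∨ BC a.toForm b.toForm

/-! ### Ordinals denoted by bracket worms, and normal forms -/

/-- The translation `*` of bracket worms into worms of `RC_{Γ₀}`: `⊤* = ⊤` and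
`((a) b)* = ⟨o(a*)⟩ b*`. -/
noncomputable def BWorm.star : BWorm → Worm
  | .top => []
  | .br a b => wormO Γ₀ a.star :: b.star

/-- The ordinal `o*(a) = o(a*)` denoted by the bracket worm `a`. -/
noncomputable def BWorm.ostar (a : BWorm) : Ordinal.{0} := wormO Γ₀ a.star

/-- The bracket normal forms. -/
inductive NF : BWorm → Prop
  | top : NF .top
  | br {a b : BWorm} : NF a → NF b → BNF Γ₀ (BWorm.br a b).star → NF (.br a b)

/-- The relation `⊴` on the set of bracket normal forms. -/
def nfLE (a b : {a : BWorm // NF a}) : Prop := BWorm.le a.1 b.1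

/-! ### Well-orders -/

/-- A well-order, given by its non-strict order relation: a total antisymmetric preorder
in which every non-empty subset has a least element. -/
structure IsWellOrderLE {X : Type*} (r : X → X → Prop) : Prop where
  refl : ∀ a, r a a
  trans : ∀ a b c, r a b → r b c → r a c
  total : ∀ a b, r a b ∨ r b a
  antisymm : ∀ a b, r a b → r b a → a = b
  exists_least : ∀ S : Set X, S.Nonempty → ∃ m ∈ S, ∀ b ∈ S, r m b

/-- The strict part of a preorder. -/
def strictPart {X : Type*} (r : X → X → Prop) (a b : X) : Prop := r a b ∧ ¬ r b a

end BracketCalculus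

/-!
The ordinals of the bracket normal forms are computed by comparing normal worms, once and for all in
an abstract calculus whose laws both the reflection calculus and the bracket calculus satisfy.

*Weights.* A non-empty worm is split as `C ⟨α⟩ X` at the first occurrence of its least modality
`α`. Its weight relative to a lower bound `β` is `e^{-β+α} (weight α X + ω ^ weight (α + 1) C)`,
where the hyperexponentials `e^ξ` are built from the Veblen functions and satisfy
`e^{ξ+ζ} = e^ξ ∘ e^ζ` and `1 + e^1 x = ω ^ x`. A worm is normal if, recursively, the weight of `C`
is at most that of the first block of `X`. A normal worm is determined by its weight
(`IsNormalWorm.eq_of_weight_eq`), and every ordinal below `Γ₀` is the weight of a normal worm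
(`exists_isNormalWorm_weight_eq`): an ordinal `x = ω ^ x` below `Γ₀` is a value of some `e^ξ` with
exponent and argument below `x`, and `e^ξ` corresponds to adding `ξ` to all modalities on the left.

*Comparison.* If modalities are compared as the ordinals assigned to them, the calculus proves that
a normal worm of smaller weight is below one of larger weight (`WormSystem.form_le_dia_form`).

*The reflection calculus.* No worm is below itself (`not_wlt_self`): a derivation involves only
finitely many modalities, and these are interpreted in a Kripke model on the ordinals built from the
function "last exponent of the Cantor normal form". As every worm is equivalent to a normal one
(`exists_isNormalWorm_equiv`), `<₀` compares weights of normal forms, hence is well-founded, and as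
all ordinals below `Γ₀` occur, the order type of a worm is the weight of its normal form
(`wormO_eq_normalWeight`). The comparison also identifies Beklemishev normal forms with normal worms
(`BNF.isNormalWorm`, `IsNormalWorm.bnf`).

*The bracket calculus.* The translation `*` is sound (`BC.toRC`). Conversely, by induction on the
nesting depth the modalities of bracket normal forms are compared by the calculus as the ordinals
they denote, so the abstract comparison applies to the normal forms themselves (`NF.eq_and_lt`).
A worm below `Γ₀` has order type larger than all its modalities, so by induction every ordinal below
`Γ₀` is denoted by a bracket normal form (`exists_nf_ostar_eq`).
-/

namespace BracketCalculus
open Ordinal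

/-! ### Hyperexponentials -/

/-- The hyperexponential `e^{ω^ρ}`: it fixes `0`, and sends `1 + x` to `veblen ρ x` if `ρ > 0`
and to `ω ^ (1 + x)` if `ρ = 0`. -/
noncomputable def hyperexpBase (ρ x : Ordinal.{0}) : Ordinal.{0} :=
  if x = 0 then 0 else veblen ρ (if ρ = 0 then x else x - 1)

@[simp] theorem hyperexpBase_zero_right (ρ : Ordinal.{0}) : hyperexpBase ρ 0 = 0 := by
  simp [hyperexpBase]

theorem sub_one_lt_sub_one {x y : Ordinal.{0}} (hx : x ≠ 0) (h : x < y) : x - 1 < y - 1 := by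
  have hx1 : 1 ≤ x := Order.one_le_iff_ne_zero.2 hx
  have h1 := Ordinal.add_sub_cancel_of_le hx1
  have h2 := Ordinal.add_sub_cancel_of_le (hx1.trans h.le)
  rw [← h1, ← h2] at h
  exact (add_lt_add_iff_left 1).1 h

theorem hyperexpBase_strictMono (ρ : Ordinal.{0}) : StrictMono (hyperexpBase ρ) := by
  intro x y hxy
  have hy : y ≠ 0 := (bot_le.trans_lt hxy).ne'
  by_cases hx : x = 0
  · simp [hyperexpBase, hx, hy]
  · simp only [hyperexpBase, hx, hy, if_false, veblen_lt_veblen_iff_right]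
    split_ifs
    · exact hxy
    · exact sub_one_lt_sub_one hx hxy

theorem one_add_eq_of_opow_eq_self {y : Ordinal.{0}} (h : ω ^ y = y) : 1 + y = y := by
  apply one_add_of_omega0_le
  have h0 : y ≠ 0 := by
    rintro rfl
    simp at h
  calc ω = ω ^ (1 : Ordinal) := (opow_one ω).symm
    _ ≤ ω ^ y := opow_le_opow_right omega0_pos (Order.one_le_iff_ne_zero.2 h0)
    _ = y := h

theorem sub_one_eq_of_opow_eq_self {y : Ordinal.{0}} (h : ω ^ y = y) : y - 1 = y := by
  conv_lhs => rw [← one_add_eq_of_opow_eq_self h]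
  simp

theorem hyperexpBase_of_lt {ρ σ : Ordinal.{0}} (h : ρ < σ) (x : Ordinal.{0}) :
    hyperexpBase ρ (hyperexpBase σ x) = hyperexpBase σ x := by
  have hσ : σ ≠ 0 := (bot_le.trans_lt h).ne'
  by_cases hx : x = 0
  · simp [hx]
  · have h0 : ω ^ veblen σ (x - 1) = veblen σ (x - 1) := by
      simpa using veblen_veblen_of_lt (bot_le.trans_lt h : 0 < σ) (x - 1)
    have h1 : veblen σ (x - 1) ≠ 0 := veblen_pos.ne'
    simp only [hyperexpBase, hx, hσ, h1, if_false]
    split_ifs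
    · exact veblen_veblen_of_lt h _
    · rw [sub_one_eq_of_opow_eq_self h0, veblen_veblen_of_lt h]

theorem veblen_lt_gamma_zero {ρ x : Ordinal.{0}} (hρ : ρ < Γ₀) (hx : x < Γ₀) :
    veblen ρ x < Γ₀ := by
  rw [← veblen_gamma_zero 0, veblen_lt_veblen_iff]
  exact Or.inr (Or.inl ⟨hρ, by rwa [veblen_gamma_zero]⟩)

theorem opow_omega0_lt_gamma_zero {x : Ordinal.{0}} (hx : x < Γ₀) : ω ^ x < Γ₀ := by
  simpa using veblen_lt_gamma_zero (gamma_pos (o := 0)) hx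

theorem opow_gamma_zero : ω ^ (Γ₀ : Ordinal.{0}) = Γ₀ := by
  have := veblen_veblen_of_lt (gamma_pos (o := 0)) (0 : Ordinal.{0})
  simpa [veblen_gamma_zero] using this

theorem add_lt_gamma_zero {x y : Ordinal.{0}} (hx : x < Γ₀) (hy : y < Γ₀) : x + y < Γ₀ := by
  rw [← opow_gamma_zero] at *
  exact isPrincipal_add_omega0_opow _ hx hy

theorem hyperexpBase_lt_gamma_zero {ρ x : Ordinal.{0}} (hρ : ρ < Γ₀) (hx : x < Γ₀) :
    hyperexpBase ρ x < Γ₀ := by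
  unfold hyperexpBase
  split_ifs
  · exact gamma_pos
  · exact veblen_lt_gamma_zero hρ hx
  · exact veblen_lt_gamma_zero hρ ((Ordinal.sub_le_self _ _).trans_lt hx)

/-- The hyperexponential `e^ξ`: the composition of the functions `e^{ω^ρ}` along the Cantor
normal form of `ξ`. -/
noncomputable def hyperexp (ξ x : Ordinal.{0}) : Ordinal.{0} :=
  if _h : ξ = 0 then x else hyperexpBase (log ω ξ) (hyperexp (ξ - ω ^ log ω ξ) x)
termination_by ξ
decreasing_by exact sub_omega0_opow_log_lt _h

@[simp] theorem hyperexp_zero (x : Ordinal.{0}) : hyperexp 0 x = x := by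
  rw [hyperexp]; simp

theorem hyperexp_of_ne_zero {ξ : Ordinal.{0}} (h : ξ ≠ 0) (x : Ordinal.{0}) :
    hyperexp ξ x = hyperexpBase (log ω ξ) (hyperexp (ξ - ω ^ log ω ξ) x) := by
  rw [hyperexp, dif_neg h]

/-- The law `e^{ξ+ζ} = e^ξ ∘ e^ζ` for `ξ = ω ^ ρ`. If `ω ^ ρ` is absorbed by `ξ`, it holds because
the values of `veblen σ` are fixed points of `veblen ρ` for `ρ < σ`. -/
theorem hyperexp_opow_add (ρ ξ x : Ordinal.{0}) :
    hyperexp (ω ^ ρ + ξ) x = hyperexpBase ρ (hyperexp ξ x) := by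
  have hpos : (ω : Ordinal.{0}) ^ ρ ≠ 0 := (opow_pos ρ omega0_pos).ne'
  rcases lt_or_ge ξ (ω ^ Order.succ ρ) with h | h
  · have hlog : log ω (ω ^ ρ + ξ) = ρ := by
      rw [log_eq_iff one_lt_omega0 (by simp [hpos])]
      refine ⟨le_add_of_nonneg_right bot_le, ?_⟩
      exact isPrincipal_add_omega0_opow _
        ((opow_lt_opow_iff_right one_lt_omega0).2 (Order.lt_succ ρ)) h
    rw [hyperexp_of_ne_zero (by simp [hpos]), hlog, Ordinal.add_sub_cancel]
  · rw [add_of_omega0_opow_le ((opow_lt_opow_iff_right one_lt_omega0).2 (Order.lt_succ ρ)) h]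
    have hξ : ξ ≠ 0 := ((opow_pos _ omega0_pos).trans_le h).ne'
    have hlog : ρ < log ω ξ := by
      rwa [← Order.succ_le_iff, ← opow_le_iff_le_log one_lt_omega0 hξ]
    rw [hyperexp_of_ne_zero hξ, hyperexpBase_of_lt hlog]

theorem opow_log_add_sub {ξ : Ordinal.{0}} (h : ξ ≠ 0) : ω ^ log ω ξ + (ξ - ω ^ log ω ξ) = ξ :=
  Ordinal.add_sub_cancel_of_le (opow_log_le_self ω h)

theorem hyperexp_add (ξ ζ x : Ordinal.{0}) :
    hyperexp (ξ + ζ) x = hyperexp ξ (hyperexp ζ x) := by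
  induction ξ using WellFoundedLT.induction with
  | ind ξ ih =>
    by_cases h : ξ = 0
    · simp [h]
    · rw [hyperexp_of_ne_zero h, ← ih _ (sub_omega0_opow_log_lt h), ← hyperexp_opow_add,
        ← add_assoc, opow_log_add_sub h]

theorem hyperexp_strictMono (ξ : Ordinal.{0}) : StrictMono (hyperexp ξ) := by
  induction ξ using WellFoundedLT.induction with
  | ind ξ ih =>
    intro x y hxy
    by_cases h : ξ = 0
    · simpa [h] using hxy
    · rw [hyperexp_of_ne_zero h, hyperexp_of_ne_zero h]
      exact hyperexpBase_strictMono _ (ih _ (sub_omega0_opow_log_lt h) hxy)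

@[simp] theorem hyperexp_zero_right (ξ : Ordinal.{0}) : hyperexp ξ 0 = 0 := by
  induction ξ using WellFoundedLT.induction with
  | ind ξ ih =>
    by_cases h : ξ = 0
    · simp [h]
    · rw [hyperexp_of_ne_zero h, ih _ (sub_omega0_opow_log_lt h), hyperexpBase_zero_right]

theorem hyperexp_opow (ρ x : Ordinal.{0}) : hyperexp (ω ^ ρ) x = hyperexpBase ρ x := by
  simpa using hyperexp_opow_add ρ 0 x

theorem one_add_hyperexp_one (x : Ordinal.{0}) : 1 + hyperexp 1 x = ω ^ x := by
  have h := hyperexp_opow 0 x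
  rw [opow_zero] at h
  rw [h, hyperexpBase]
  split_ifs with hx
  · simp [hx]
  · rw [veblen_zero_apply]
    apply one_add_of_omega0_le
    simpa using opow_le_opow_right omega0_pos (Order.one_le_iff_ne_zero.2 hx)
  · simp_all

theorem hyperexp_lt_gamma_zero {ξ x : Ordinal.{0}} (hξ : ξ < Γ₀) (hx : x < Γ₀) :
    hyperexp ξ x < Γ₀ := by
  induction ξ using WellFoundedLT.induction with
  | ind ξ ih =>
    by_cases h : ξ = 0
    · simpa [h] using hx
    · have h1 := sub_omega0_opow_log_lt h
      rw [hyperexp_of_ne_zero h]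
      exact hyperexpBase_lt_gamma_zero ((log_le_self _ _).trans_lt hξ) (ih _ h1 (h1.trans hξ))

/-- Every fixed point of `ω ^ ·` below `Γ₀` is a value of a hyperexponential with exponent and
argument below it. -/
theorem exists_hyperexp_eq {x : Ordinal.{0}} (hx : x < Γ₀) (h : ω ^ x = x) :
    ∃ ξ < x, ∃ y < x, hyperexp ξ y = x := by
  have hx0 : x ≠ 0 := by rintro rfl; simp at h
  have hlim : ∀ z < x, ω ^ z < x := fun z hz => by
    conv_rhs => rw [← h]
    exact (opow_lt_opow_iff_right one_lt_omega0).2 hz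
  have h1 : invVeblen₁ x < x := by
    rw [invVeblen₁_lt_iff]
    refine ⟨hx0, ?_⟩
    rintro ⟨a, rfl⟩
    exact absurd hx (not_lt.2 (monotone_gamma bot_le))
  have h2 : invVeblen₁ x ≠ 0 := by
    intro h0
    have := lt_veblen_invVeblen₁ x
    rw [h0, veblen_zero_apply, h] at this
    exact this.false
  have h3 := veblen_invVeblen₁_invVeblen₂ x
  have h4 : invVeblen₂ x < x := by
    have := invVeblen₂_lt x
    rwa [h] at this
  refine ⟨ω ^ invVeblen₁ x, hlim _ h1, 1 + invVeblen₂ x, ?_, ?_⟩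
  · rw [← h] at h4 ⊢
    refine isPrincipal_add_omega0_opow _ (one_lt_opow.2 ⟨one_lt_omega0, hx0⟩) h4
  · rw [hyperexp_opow, hyperexpBase, if_neg (by simp), if_neg h2, Ordinal.add_sub_cancel, h3, h]

/-- Below a multiple of `ω ^ v`, adding `ω ^ w` with `w < v` does not lead out. -/
theorem add_opow_lt_of_dvd {v w x z : Ordinal.{0}} (hd : ω ^ v ∣ x) (hw : w < v) (hz : z < x) :
    z + ω ^ w < x := by
  obtain ⟨q, rfl⟩ := hd
  have hp : (ω : Ordinal.{0}) ^ v ≠ 0 := (opow_pos v omega0_pos).ne'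
  have h1 : z / ω ^ v < q := (Ordinal.lt_mul_iff_div_lt hp).1 hz
  have h2 := Ordinal.div_add_mod z (ω ^ v)
  have h3 : z % ω ^ v < ω ^ v := Ordinal.mod_lt _ hp
  calc z + ω ^ w = ω ^ v * (z / ω ^ v) + (z % ω ^ v + ω ^ w) := by rw [← add_assoc, h2]
    _ < ω ^ v * (z / ω ^ v) + ω ^ v := by
      apply (add_lt_add_iff_left _).2
      exact isPrincipal_add_omega0_opow _ h3 ((opow_lt_opow_iff_right one_lt_omega0).2 hw)
    _ = ω ^ v * (z / ω ^ v + 1) := by rw [mul_add_one]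
    _ ≤ ω ^ v * q := by gcongr; exact Order.add_one_le_of_lt h1

/-- If `ω ^ c` divides `z + ω ^ w`, then `c ≤ w`: the exponent `w` is the last one of the Cantor
normal form. -/
theorem le_of_opow_dvd_add_opow {c w z : Ordinal.{0}} (h : ω ^ c ∣ z + ω ^ w) : c ≤ w := by
  by_contra! hlt
  exact (add_opow_lt_of_dvd h hlt (lt_add_of_pos_right _ (opow_pos w omega0_pos))).false

theorem lt_hyperexp_one {ξ : Ordinal.{0}} (hξ : ξ < Γ₀) : ξ < hyperexp ξ 1 := by
  by_cases h : ξ = 0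
  · simp [h]
  have h1 : hyperexpBase (log ω ξ) 1 ≤ hyperexp ξ 1 := by
    rw [hyperexp_of_ne_zero h]
    exact (hyperexpBase_strictMono _).monotone ((hyperexp_strictMono _).le_apply)
  refine lt_of_lt_of_le ((lt_opow_succ_log_self one_lt_omega0 ξ).trans_le ?_) h1
  generalize hρ : log ω ξ = ρ
  have hρ' : ρ < Γ₀ := hρ ▸ (log_le_self _ _).trans_lt hξ
  rw [hyperexpBase, if_neg one_ne_zero]
  split_ifs with h0
  · simp [h0]
  · rw [Ordinal.sub_self]
    have h2 : ρ < veblen ρ 0 := by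
      by_contra! hle
      exact (gamma_zero_le_of_veblen_le hle).not_gt hρ'
    have h3 : ω ^ veblen ρ 0 = veblen ρ 0 := by
      simpa using veblen_veblen_of_lt (pos_iff_ne_zero.2 h0) 0
    calc ω ^ Order.succ ρ ≤ ω ^ veblen ρ 0 :=
          opow_le_opow_right omega0_pos (Order.succ_le_of_lt h2)
      _ = veblen ρ 0 := h3

/-! ### Normal worms and their weights -/

/-- The factorisation `A = C ⟨α⟩ X` of a non-empty worm at the first occurrence of its least
modality `α`. -/
structure Splits (A C : Worm) (α : Ordinal.{0}) (X : Worm) : Prop where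
  eq : A = C ++ α :: X
  lt : ∀ x ∈ C, α < x
  le : ∀ x ∈ X, α ≤ x

theorem exists_splits {A : Worm} (h : A ≠ []) : ∃ C α X, Splits A C α X := by
  induction A with
  | nil => exact absurd rfl h
  | cons ξ B ih =>
    by_cases hB : B = []
    · exact ⟨[], ξ, [], by simp [hB], by simp, by simp⟩
    obtain ⟨C, α, X, rfl, h1, h2⟩ := ih hB
    rcases le_or_gt ξ α with hξ | hξ
    · refine ⟨[], ξ, C ++ α :: X, rfl, by simp, ?_⟩
      simp only [List.mem_append, List.mem_cons]
      rintro x (hx | rfl | hx)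
      exacts [hξ.trans (h1 x hx).le, hξ, hξ.trans (h2 x hx)]
    · refine ⟨ξ :: C, α, X, rfl, ?_, h2⟩
      simp only [List.mem_cons]
      rintro x (rfl | hx)
      exacts [hξ, h1 x hx]

theorem Splits.le_of_mem {A C X : Worm} {α x : Ordinal.{0}} (h : Splits A C α X) (hx : x ∈ A) :
    α ≤ x := by
  rw [h.eq, List.mem_append, List.mem_cons] at hx
  rcases hx with hx | rfl | hx
  exacts [(h.lt x hx).le, le_rfl, h.le x hx]

theorem Splits.mem {A C X : Worm} {α : Ordinal.{0}} (h : Splits A C α X) : α ∈ A := by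
  simp [h.eq]

theorem forall_lt_or_splits {A : Worm} {α : Ordinal.{0}} (h : ∀ x ∈ A, α ≤ x) :
    (∀ x ∈ A, α < x) ∨ ∃ C X, Splits A C α X := by
  by_cases hm : α ∈ A
  · obtain ⟨C, γ, X, hs⟩ := exists_splits (List.ne_nil_of_mem hm)
    obtain rfl : γ = α := le_antisymm (hs.le_of_mem hm) (h γ hs.mem)
    exact Or.inr ⟨C, X, hs⟩
  · exact Or.inl fun x hx => (h x hx).lt_of_ne fun h => hm (h ▸ hx)

theorem takeWhile_lt_append_cons {C X : Worm} {α : Ordinal.{0}} (h : ∀ x ∈ C, α < x) :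
    (C ++ α :: X).takeWhile (α < ·) = C := by
  rw [List.takeWhile_append_of_pos (by simpa using h)]
  simp

theorem takeWhile_lt_eq_self {X : Worm} {α : Ordinal.{0}} (h : ∀ x ∈ X, α < x) :
    X.takeWhile (α < ·) = X := by
  simpa using h

theorem Splits.unique {A C D X Y : Worm} {α β : Ordinal.{0}} (h : Splits A C α X)
    (h' : Splits A D β Y) : C = D ∧ α = β ∧ X = Y := by
  obtain rfl : α = β := le_antisymm (h.le_of_mem h'.mem) (h'.le_of_mem h.mem)
  have hCD : C = D := by
    rw [← takeWhile_lt_append_cons (X := X) h.lt, ← h.eq, h'.eq, takeWhile_lt_append_cons h'.lt]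
  subst hCD
  have := h.eq.symm.trans h'.eq
  simpa using this

open Classical in
/-- The weight of a worm `A` relative to a lower bound `β` of its modalities: `0` for `⊤`, and
`e^{-β+α} (weight α X + ω ^ weight (α+1) C)` for `A = C ⟨α⟩ X` split at the first occurrence of the
least modality `α`. For worms in normal form, `weight 0` is the order type. -/
noncomputable def weight (β : Ordinal.{0}) (A : Worm) : Ordinal.{0} :=
  if h : ∃ p : Worm × Ordinal.{0} × Worm, Splits A p.1 p.2.1 p.2.2 then
    hyperexp (h.choose.2.1 - β) (weight h.choose.2.1 h.choose.2.2 +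
      ω ^ weight (h.choose.2.1 + 1) h.choose.1)
  else 0
termination_by A.length
decreasing_by
  all_goals
    have := congrArg List.length h.choose_spec.eq
    simp only [List.length_append, List.length_cons] at this
    omega

@[simp] theorem weight_nil (β : Ordinal.{0}) : weight β [] = 0 := by
  rw [weight, dif_neg]
  rintro ⟨p, h⟩
  simpa using h.eq

theorem Splits.weight_eq {A C X : Worm} {α : Ordinal.{0}} (h : Splits A C α X) (β : Ordinal.{0}) :
    weight β A = hyperexp (α - β) (weight α X + ω ^ weight (α + 1) C) := by
  have hex : ∃ p : Worm × Ordinal.{0} × Worm, Splits A p.1 p.2.1 p.2.2 := ⟨(C, α, X), h⟩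
  rw [weight, dif_pos hex]
  obtain ⟨h1, h2, h3⟩ := hex.choose_spec.unique h
  rw [h1, h2, h3]

theorem weight_append_cons {C X : Worm} {α : Ordinal.{0}} (hC : ∀ x ∈ C, α < x)
    (hX : ∀ x ∈ X, α ≤ x) : weight α (C ++ α :: X) = weight α X + ω ^ weight (α + 1) C := by
  rw [Splits.weight_eq ⟨rfl, hC, hX⟩, Ordinal.sub_self, hyperexp_zero]

/-- The weights relative to different lower bounds are related by a hyperexponential. -/
theorem weight_eq_hyperexp {A : Worm} {β γ : Ordinal.{0}} (h : β ≤ γ) (hA : ∀ x ∈ A, γ ≤ x) :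
    weight β A = hyperexp (γ - β) (weight γ A) := by
  by_cases hn : A = []
  · simp [hn]
  obtain ⟨C, α, X, hs⟩ := exists_splits hn
  rw [hs.weight_eq, hs.weight_eq, ← hyperexp_add]
  congr 1
  have h1 := hA α hs.mem
  have : β + (γ - β + (α - γ)) = α := by
    rw [← add_assoc, Ordinal.add_sub_cancel_of_le h, Ordinal.add_sub_cancel_of_le h1]
  conv_lhs => rw [← this]
  exact Ordinal.add_sub_cancel _ _

theorem weight_lt_weight_iff {A B : Worm} {β γ : Ordinal.{0}} (h : β ≤ γ) (hA : ∀ x ∈ A, γ ≤ x)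
    (hB : ∀ x ∈ B, γ ≤ x) : weight β A < weight β B ↔ weight γ A < weight γ B := by
  rw [weight_eq_hyperexp h hA, weight_eq_hyperexp h hB, (hyperexp_strictMono _).lt_iff_lt]

theorem weight_eq_weight_iff {A B : Worm} {β γ : Ordinal.{0}} (h : β ≤ γ) (hA : ∀ x ∈ A, γ ≤ x)
    (hB : ∀ x ∈ B, γ ≤ x) : weight β A = weight β B ↔ weight γ A = weight γ B := by
  rw [weight_eq_hyperexp h hA, weight_eq_hyperexp h hB, (hyperexp_strictMono _).injective.eq_iff]

theorem one_add_weight {A : Worm} {α : Ordinal.{0}} (h : ∀ x ∈ A, α < x) :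
    1 + weight α A = ω ^ weight (α + 1) A := by
  rw [weight_eq_hyperexp (le_add_of_nonneg_right bot_le : α ≤ α + 1)
    (fun x hx => Order.add_one_le_of_lt (h x hx)), Ordinal.add_sub_cancel, one_add_hyperexp_one]

/-- Worms `⊤` and `C ⟨α⟩ X`, split at the first occurrence of the least modality, with `C` and `X`
normal and the weight of `C` at most that of the first block of `X`. This is the ordinal-theoretic
counterpart of Beklemishev normal form. -/
inductive IsNormalWorm : Worm → Prop
  | nil : IsNormalWorm []
  | append {C X : Worm} {α : Ordinal.{0}} : (∀ x ∈ C, α < x) → (∀ x ∈ X, α ≤ x) →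
      IsNormalWorm C → IsNormalWorm X →
      weight (α + 1) C ≤ weight (α + 1) (X.takeWhile (α < ·)) → IsNormalWorm (C ++ α :: X)

theorem IsNormalWorm.of_splits {A C X : Worm} {α : Ordinal.{0}} (h : IsNormalWorm A)
    (hs : Splits A C α X) : IsNormalWorm C ∧ IsNormalWorm X ∧
      weight (α + 1) C ≤ weight (α + 1) (X.takeWhile (α < ·)) := by
  cases h with
  | nil => simpa using hs.eq
  | append h1 h2 h3 h4 h5 =>
    obtain ⟨rfl, rfl, rfl⟩ := hs.unique ⟨rfl, h1, h2⟩
    exact ⟨h3, h4, h5⟩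

/-- The exponent of the last term of the Cantor normal form of `1 + weight α X` is the weight of
the first block of `X`. -/
theorem IsNormalWorm.opow_dvd {X : Worm} {α c : Ordinal.{0}} (h : IsNormalWorm X)
    (hX : ∀ x ∈ X, α ≤ x) (hc : c ≤ weight (α + 1) (X.takeWhile (α < ·))) :
    ω ^ c ∣ 1 + weight α X := by
  induction h with
  | nil => simp_all
  | @append D Y β h1 h2 h3 h4 h5 _ ih =>
    rcases (hX β (by simp)).eq_or_lt with rfl | hlt
    · rw [takeWhile_lt_append_cons h1] at hc
      rw [weight_append_cons h1 h2, ← add_assoc]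
      exact dvd_add (ih h2 (hc.trans h5)) (opow_dvd_opow _ hc)
    · have hs : ∀ x ∈ D ++ β :: Y, α < x := fun x hx =>
        hlt.trans_le ((⟨rfl, h1, h2⟩ : Splits _ D β Y).le_of_mem hx)
      rw [takeWhile_lt_eq_self hs] at hc
      rw [one_add_weight hs]
      exact opow_dvd_opow _ hc

/-- The converse of `IsNormalWorm.opow_dvd`, for arbitrary worms. -/
theorem le_weight_takeWhile_of_dvd {X : Worm} {α c : Ordinal.{0}} (hX : ∀ x ∈ X, α ≤ x)
    (hc : ω ^ c ∣ 1 + weight α X) : c ≤ weight (α + 1) (X.takeWhile (α < ·)) := by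
  rcases forall_lt_or_splits hX with hs | ⟨C, Y, hs⟩
  · rw [takeWhile_lt_eq_self hs]
    rw [one_add_weight hs] at hc
    exact (opow_dvd_opow_iff one_lt_omega0).1 hc
  · rw [hs.eq, takeWhile_lt_append_cons hs.lt]
    rw [hs.eq, weight_append_cons hs.lt hs.le, ← add_assoc] at hc
    exact le_of_opow_dvd_add_opow hc

theorem weight_lt_gamma_zero {A : Worm} {β : Ordinal.{0}} (hA : ∀ x ∈ A, x < Γ₀) :
    weight β A < Γ₀ := by
  induction hn : A.length using Nat.strong_induction_on generalizing A β with
  | _ n ih =>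
    by_cases h0 : A = []
    · simp [h0]
    obtain ⟨C, α, X, hs⟩ := exists_splits h0
    have hl := congrArg List.length hs.eq
    simp only [List.length_append, List.length_cons] at hl
    rw [hs.weight_eq]
    refine hyperexp_lt_gamma_zero ((Ordinal.sub_le_self _ _).trans_lt (hA α hs.mem))
      (add_lt_gamma_zero ?_ (opow_omega0_lt_gamma_zero ?_))
    · exact ih X.length (by omega) (fun x hx => hA x (by simp [hs.eq, hx])) rfl
    · exact ih C.length (by omega) (fun x hx => hA x (by simp [hs.eq, hx])) rfl

/-! ### Comparison of normal worms by weight -/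

theorem lt_of_add_opow_lt_add_opow {x y c d : Ordinal.{0}} (h : x + ω ^ c < y + ω ^ d)
    (h' : y < x + ω ^ c) : c < d := by
  by_contra! hdc
  have hle : (ω : Ordinal.{0}) ^ d ≤ ω ^ c := opow_le_opow_right omega0_pos hdc
  rcases le_or_gt y x with hyx | hyx
  · exact h.not_ge (add_le_add hyx hle)
  · obtain ⟨r, rfl⟩ := exists_add_of_le hyx.le
    have hr : r < ω ^ c := (add_lt_add_iff_left x).1 h'
    refine h.not_ge ?_
    calc x + r + ω ^ d ≤ x + (r + ω ^ c) := by rw [add_assoc]; gcongr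
      _ = x + ω ^ c := by rw [add_omega0_opow hr]

theorem add_opow_lt_opow_of_dvd {z a d : Ordinal.{0}} (hz : z ≠ 0) (hd : ω ^ d ∣ z)
    (h : z < ω ^ a) : z + ω ^ d < ω ^ a :=
  add_opow_lt_of_dvd dvd_rfl
    ((opow_lt_opow_iff_right one_lt_omega0).1 ((Ordinal.le_of_dvd hz hd).trans_lt h)) h

/-- A normal worm is determined by its weight. -/
theorem IsNormalWorm.eq_of_weight_eq {A B : Worm} (hA : IsNormalWorm A) (hB : IsNormalWorm B)
    {β : Ordinal.{0}} (hβA : ∀ x ∈ A, β ≤ x) (hβB : ∀ x ∈ B, β ≤ x)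
    (h : weight β A = weight β B) : A = B := by
  -- a worm containing `α` and a worm with all modalities above `α` have different weights
  have key : ∀ {A B C X : Worm} {α : Ordinal.{0}}, IsNormalWorm A → Splits A C α X →
      (∀ x ∈ B, α < x) → weight α A ≠ weight α B := by
    intro A B C X α hA hs hB h
    obtain ⟨_, h2, h3⟩ := hA.of_splits hs
    have h4 : 1 + weight α X + ω ^ weight (α + 1) C = ω ^ weight (α + 1) B := by
      rw [← one_add_weight hB, ← h, hs.eq, weight_append_cons hs.lt hs.le, add_assoc]
    have hpos : (0 : Ordinal.{0}) < ω ^ weight (α + 1) C := opow_pos _ omega0_pos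
    exact (add_opow_lt_opow_of_dvd (by simp) (h2.opow_dvd hs.le h3)
      (h4 ▸ lt_add_of_pos_right _ hpos)).ne h4
  induction hn : A.length + B.length using Nat.strong_induction_on generalizing A B β with
  | _ n ih =>
    by_cases h0 : A ++ B = []
    · simp_all
    obtain ⟨U, α, V, hs⟩ := exists_splits h0
    have hαA : ∀ x ∈ A, α ≤ x := fun x hx => hs.le_of_mem (List.mem_append_left _ hx)
    have hαB : ∀ x ∈ B, α ≤ x := fun x hx => hs.le_of_mem (List.mem_append_right _ hx)
    have hβα : β ≤ α := (List.mem_append.1 hs.mem).elim (hβA α) (hβB α)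
    rw [weight_eq_weight_iff hβα hαA hαB] at h
    rcases forall_lt_or_splits hαA with hA' | ⟨C, X, hsA⟩ <;>
      rcases forall_lt_or_splits hαB with hB' | ⟨D, Y, hsB⟩
    · rcases List.mem_append.1 hs.mem with hm | hm
      exacts [((hA' α hm).false).elim, ((hB' α hm).false).elim]
    · exact absurd h.symm (key hB hsB hA')
    · exact absurd h (key hA hsA hB')
    obtain ⟨h1, h2, h3⟩ := hA.of_splits hsA
    obtain ⟨h4, h5, h6⟩ := hB.of_splits hsB
    have hlA := congrArg List.length hsA.eq
    have hlB := congrArg List.length hsB.eq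
    simp only [List.length_append, List.length_cons] at hlA hlB
    have d1 := h2.opow_dvd hsA.le h3
    have d2 := h5.opow_dvd hsB.le h6
    rw [hsA.eq, hsB.eq, weight_append_cons hsA.lt hsA.le, weight_append_cons hsB.lt hsB.le,
      ← add_right_inj (1 : Ordinal.{0}), ← add_assoc, ← add_assoc] at h
    -- by normality both sides of `h` are multiples of the powers they end with, so the last terms
    -- agree, and `1 + weight α X`, `1 + weight α Y` are multiples of the common one
    have hCD : weight (α + 1) C = weight (α + 1) D := le_antisymm
      (le_of_opow_dvd_add_opow (h ▸ dvd_add d1 dvd_rfl))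
      (le_of_opow_dvd_add_opow (h.symm ▸ dvd_add d2 dvd_rfl))
    have hXY : weight α X = weight α Y := by
      rw [hCD] at d1 h
      obtain ⟨p, hp⟩ := d1
      obtain ⟨q, hq⟩ := d2
      have hne : (ω : Ordinal.{0}) ^ weight (α + 1) D ≠ 0 := (opow_pos _ omega0_pos).ne'
      rw [hp, hq, ← mul_add_one, ← mul_add_one, mul_right_inj' hne, Order.add_one_inj] at h
      exact (add_right_inj 1).1 (hp.trans (h ▸ hq.symm))
    rw [hsA.eq, hsB.eq,
      ih (C.length + D.length) (by omega) h1 h4 (fun x hx => Order.add_one_le_of_lt (hsA.lt x hx))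
        (fun x hx => Order.add_one_le_of_lt (hsB.lt x hx)) hCD rfl,
      ih (X.length + Y.length) (by omega) h2 h5 hsA.le hsB.le hXY rfl]

/-! ### Every ordinal below `Γ₀` is the weight of a normal worm -/

theorem Splits.map_add {A C X : Worm} {α : Ordinal.{0}} (h : Splits A C α X) (ξ : Ordinal.{0}) :
    Splits (A.map (ξ + ·)) (C.map (ξ + ·)) (ξ + α) (X.map (ξ + ·)) := by
  refine ⟨by simp [h.eq], ?_, ?_⟩
  · simpa using h.lt
  · simpa using h.le

theorem weight_map_add (ξ β : Ordinal.{0}) (A : Worm) :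
    weight (ξ + β) (A.map (ξ + ·)) = weight β A := by
  induction hn : A.length using Nat.strong_induction_on generalizing A β with
  | _ n ih =>
    by_cases h0 : A = []
    · simp [h0]
    obtain ⟨C, α, X, hs⟩ := exists_splits h0
    have hl := congrArg List.length hs.eq
    simp only [List.length_append, List.length_cons] at hl
    rw [hs.weight_eq, (hs.map_add ξ).weight_eq, add_assoc, ih C.length (by omega) _ _ rfl,
      ih X.length (by omega) _ _ rfl]
    congr 1
    exact Ordinal.add_sub_add_cancel _ _ _

theorem weight_zero_map_add (ξ : Ordinal.{0}) (A : Worm) :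
    weight 0 (A.map (ξ + ·)) = hyperexp ξ (weight 0 A) := by
  have h : weight ξ (A.map (ξ + ·)) = weight 0 A := by simpa using weight_map_add ξ 0 A
  rw [weight_eq_hyperexp (β := 0) (γ := ξ) bot_le (by simp), Ordinal.sub_zero, h]

theorem IsNormalWorm.map_add {A : Worm} (h : IsNormalWorm A) (ξ : Ordinal.{0}) :
    IsNormalWorm (A.map (ξ + ·)) := by
  induction h with
  | nil => exact .nil
  | @append C X α h1 h2 h3 h4 h5 ih3 ih4 =>
    rw [List.map_append, List.map_cons]
    refine .append (by simpa using h1) (by simpa using h2) ih3 ih4 ?_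
    have : (X.map (ξ + ·)).takeWhile (ξ + α < ·) = (X.takeWhile (α < ·)).map (ξ + ·) := by
      rw [List.takeWhile_map]
      congr 2
      funext x
      simp
    rw [this, add_assoc, weight_map_add, weight_map_add]
    exact h5

theorem exists_eq_opow_mul_add_opow {z : Ordinal.{0}} (hz : z ≠ 0) :
    ∃ w q : Ordinal.{0}, z = ω ^ w * q + ω ^ w := by
  induction z using WellFoundedLT.induction with
  | ind z ih =>
    by_cases h0 : z - ω ^ log ω z = 0
    · refine ⟨log ω z, 0, ?_⟩
      conv_lhs => rw [← opow_log_add_sub hz, h0]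
      simp
    · obtain ⟨w, q, hq⟩ := ih _ (sub_omega0_opow_log_lt hz) h0
      have hw : w ≤ log ω z := by
        rw [← opow_le_iff_le_log one_lt_omega0 hz]
        calc ω ^ w ≤ ω ^ w * q + ω ^ w := le_add_of_nonneg_left bot_le
          _ ≤ z := hq ▸ Ordinal.sub_le_self _ _
      obtain ⟨t, ht⟩ := opow_dvd_opow ω hw
      refine ⟨w, t + q, ?_⟩
      conv_lhs => rw [← opow_log_add_sub hz, hq, ht]
      rw [mul_add, add_assoc]

theorem exists_isNormalWorm_weight_eq {x : Ordinal.{0}} (hx : x < Γ₀) :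
    ∃ A, IsNormalWorm A ∧ (∀ ξ ∈ A, ξ < Γ₀) ∧ weight 0 A = x := by
  induction x using WellFoundedLT.induction with
  | ind x ih =>
    by_cases hx0 : x = 0
    · exact ⟨[], .nil, by simp, by simp [hx0]⟩
    have hone : (1 : Ordinal.{0}) < Γ₀ := one_lt_omega0.trans (omega0_lt_gamma 0)
    -- `ω ^ w` is the last term of the Cantor normal form of `1 + x`
    obtain ⟨w, q, hq⟩ := exists_eq_opow_mul_add_opow (z := 1 + x) (by simp)
    have shift : w < x → ∃ C, IsNormalWorm C ∧ (∀ ξ ∈ C, ξ < Γ₀) ∧ (∀ ξ ∈ C, 0 < ξ) ∧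
        weight (0 + 1) C = w := by
      intro hw
      obtain ⟨C, h1, h2, h3⟩ := ih w hw (hw.trans hx)
      refine ⟨C.map (1 + ·), h1.map_add 1, ?_, ?_, ?_⟩
      · simp only [List.mem_map]
        rintro _ ⟨ξ, hξ, rfl⟩
        exact add_lt_gamma_zero hone (h2 ξ hξ)
      · simp only [List.mem_map]
        rintro _ ⟨ξ, hξ, rfl⟩
        exact zero_lt_one.trans_le (le_add_of_nonneg_right bot_le)
      · simpa [h3] using weight_map_add 1 0 C
    have hω : w ≠ 0 → ω ≤ (ω : Ordinal.{0}) ^ w := fun hw => by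
      simpa using opow_le_opow_right omega0_pos (Order.one_le_iff_ne_zero.2 hw)
    by_cases hq0 : q = 0
    · rw [hq0, mul_zero, zero_add] at hq
      have hw0 : w ≠ 0 := by
        rintro rfl
        rw [opow_zero] at hq
        exact hx0 ((add_right_inj (1 : Ordinal.{0})).1 (hq.trans (add_zero 1).symm))
      have hxω : ω ≤ x := by
        by_contra! hlt
        exact ((hω hw0).trans_eq hq.symm).not_gt (isPrincipal_add_omega0 one_lt_omega0 hlt)
      have hxw : x = ω ^ w := by rwa [one_add_of_omega0_le hxω] at hq
      -- here `x = ω ^ w`; if `w = x`, then `x` is a value of a larger hyperexponential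
      rcases (right_le_opow w one_lt_omega0).eq_or_lt with hw | hw
      · obtain rfl : x = w := hxw.trans hw.symm
        obtain ⟨ξ, hξ, y, hy, hξy⟩ := exists_hyperexp_eq hx hxw.symm
        obtain ⟨B, h1, h2, h3⟩ := ih y hy (hy.trans hx)
        refine ⟨B.map (ξ + ·), h1.map_add ξ, ?_, ?_⟩
        · simp only [List.mem_map]
          rintro _ ⟨ζ, hζ, rfl⟩
          exact add_lt_gamma_zero (hξ.trans hx) (h2 ζ hζ)
        · rw [weight_zero_map_add, h3, hξy]
      · obtain ⟨C, h1, h2, h3, h4⟩ := shift (hw.trans_eq hxw.symm)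
        refine ⟨C, h1, h2, ?_⟩
        have := one_add_weight h3
        rw [h4, ← hq] at this
        exact (add_right_inj 1).1 this
    · have hpos : (ω : Ordinal.{0}) ^ w * q ≠ 0 := mul_ne_zero (opow_pos w omega0_pos).ne' hq0
      obtain ⟨y, hy⟩ : ∃ y, 1 + y = ω ^ w * q :=
        ⟨_, Ordinal.add_sub_cancel_of_le (Order.one_le_iff_ne_zero.2 hpos)⟩
      -- here `x = y + ω ^ w`, and normal worms for `y` and `w` are joined by `⟨0⟩`
      have hxy : x = y + ω ^ w := by
        rw [← hy, add_assoc] at hq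
        exact (add_right_inj 1).1 hq
      have hyx : y < x := hxy ▸ lt_add_of_pos_right _ (opow_pos w omega0_pos)
      have hwx : w < x := by
        by_contra! hle
        have hw0 : w ≠ 0 := by
          rintro rfl
          exact hx0 (le_bot_iff.1 hle)
        have h1 : ω ^ w < 1 + x := calc
          ω ^ w ≤ ω ^ w * q := le_mul_of_one_le_right' (Order.one_le_iff_ne_zero.2 hq0)
          _ < 1 + x := hq ▸ lt_add_of_pos_right _ (opow_pos w omega0_pos)
        have h2 : 1 + x ≤ ω ^ w := calc
          1 + x ≤ 1 + ω ^ w := by gcongr; exact hle.trans (right_le_opow w one_lt_omega0)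
          _ = ω ^ w := one_add_of_omega0_le (hω hw0)
        exact (h1.trans_le h2).false
      obtain ⟨C, h1, h2, h3, h4⟩ := shift hwx
      obtain ⟨Y, h5, h6, h7⟩ := ih y hyx (hyx.trans hx)
      refine ⟨C ++ 0 :: Y, .append h3 (fun _ _ => bot_le) h1 h5 ?_, ?_, ?_⟩
      · rw [h4]
        exact le_weight_takeWhile_of_dvd (fun _ _ => bot_le) ⟨q, by rw [h7, hy]⟩
      · simp only [List.mem_append, List.mem_cons]
        rintro ξ (hξ | rfl | hξ)
        exacts [h2 ξ hξ, gamma_pos, h6 ξ hξ]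
      · rw [weight_append_cons h3 (fun _ _ => bot_le), h7, h4, hxy]

/-! ### Comparison of normal worms in a reflection calculus -/

/-- A calculus of strictly positive formulas `F` with modalities in `M`: the laws common to the
reflection calculus and the bracket calculus on which the comparison of normal worms rests.
`le φ ψ` stands for `φ ⊢ ψ`, and `lt x y` says that the modality `y` is stronger than `x`. -/
structure WormSystem (M F : Type*) where
  /-- The formula `⊤`. -/
  top : F
  /-- Conjunction. -/
  and : F → F → F
  /-- The modality `⟨x⟩`. -/
  dia : M → F → F
  /-- Derivability. -/
  le : F → F → Prop
  /-- The strict comparison of modalities. -/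
  lt : M → M → Prop
  refl : ∀ φ, le φ φ
  trans : ∀ {φ ψ χ}, le φ ψ → le ψ χ → le φ χ
  le_top : ∀ φ, le φ top
  and_left : ∀ φ ψ, le (and φ ψ) φ
  and_right : ∀ φ ψ, le (and φ ψ) ψ
  le_and : ∀ {φ ψ χ}, le φ ψ → le φ χ → le φ (and ψ χ)
  dia_mono : ∀ x {φ ψ}, le φ ψ → le (dia x φ) (dia x ψ)
  dia_anti : ∀ {x y} φ, lt x y → le (dia y φ) (dia x φ)
  dia_dia : ∀ x φ, le (dia x (dia x φ)) (dia x φ)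
  dia_and : ∀ {x y} φ ψ, lt x y → le (and (dia y φ) (dia x ψ)) (dia y (and φ (dia x ψ)))

namespace WormSystem

variable {M F : Type*} (S : WormSystem M F)

/-- The formula `⟨x₁⟩ ⋯ ⟨xₙ⟩ φ`. -/
def dias (a : List M) (φ : F) : F := a.foldr S.dia φ

/-- The worm `⟨x₁⟩ ⋯ ⟨xₙ⟩ ⊤` as a formula. -/
def form (a : List M) : F := S.dias a S.top

theorem dias_mono (a : List M) {φ ψ : F} (h : S.le φ ψ) : S.le (S.dias a φ) (S.dias a ψ) := by
  induction a with
  | nil => exact h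
  | cons x a ih => exact S.dia_mono x ih

theorem form_append (a b : List M) : S.form (a ++ b) = S.dias a (S.form b) := by
  simp [form, dias]

theorem form_append_le (a b : List M) : S.le (S.form (a ++ b)) (S.form a) := by
  rw [form_append]
  exact S.dias_mono a (S.le_top _)

theorem dia_dia_le {x y : M} (h : S.lt x y ∨ x = y) (φ : F) :
    S.le (S.dia y (S.dia x φ)) (S.dia x φ) := by
  rcases h with h | rfl
  · exact S.trans (S.dia_anti _ h) (S.dia_dia _ _)
  · exact S.dia_dia _ _

theorem dias_dia_le {x : M} {a : List M} (h : ∀ y ∈ a, S.lt x y ∨ x = y) (φ : F) :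
    S.le (S.dias a (S.dia x φ)) (S.dia x φ) := by
  induction a with
  | nil => exact S.refl _
  | cons y a ih =>
    simp only [List.forall_mem_cons] at h
    exact S.trans (S.dia_mono y (ih h.2)) (S.dia_dia_le h.1 φ)

/-- A conjunct `⟨x⟩ φ` can be moved inside a worm all of whose modalities are stronger. -/
theorem and_dia_le_dias {x : M} {a : List M} (h : ∀ y ∈ a, S.lt x y) (φ : F) :
    S.le (S.and (S.form a) (S.dia x φ)) (S.dias a (S.dia x φ)) := by
  induction a with
  | nil => exact S.and_right _ _
  | cons y a ih =>
    simp only [List.forall_mem_cons] at h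
    exact S.trans (S.dia_and _ _ h.1) (S.dia_mono y (ih h.2))

theorem le_form_append_cons {x : M} {a b : List M} (h : ∀ y ∈ a, S.lt x y) {φ : F}
    (ha : S.le φ (S.form a)) (hb : S.le φ (S.dia x (S.form b))) :
    S.le φ (S.form (a ++ x :: b)) := by
  rw [form_append]
  exact S.trans (S.le_and ha hb) (S.and_dia_le_dias h _)

/-- If `φ` proves `⟨y⟩ a` and `⟨x⟩ b` for `y` and the modalities of `a` stronger than `x`, then it
proves `⟨x⟩ (a ⟨x⟩ b)`. -/
theorem le_dia_form_append_cons {x y : M} {a b : List M} (hxy : S.lt x y)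
    (h : ∀ y ∈ a, S.lt x y) {φ : F} (ha : S.le φ (S.dia y (S.form a)))
    (hb : S.le φ (S.dia x (S.form b))) : S.le φ (S.dia x (S.form (a ++ x :: b))) := by
  rw [form_append]
  exact S.trans (S.trans (S.le_and ha hb) (S.dia_and _ _ hxy))
    (S.trans (S.dia_anti _ hxy) (S.dia_mono x (S.and_dia_le_dias h _)))

end WormSystem

theorem exists_splits_map {M : Type*} {v : M → Ordinal.{0}} {a : List M} {C X : Worm}
    {α : Ordinal.{0}} (h : Splits (a.map v) C α X) :
    ∃ c e x, a = c ++ e :: x ∧ c.map v = C ∧ v e = α ∧ x.map v = X := by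
  obtain ⟨c, y, rfl, hc, hy⟩ := List.map_eq_append_iff.1 h.eq
  obtain ⟨e, x, rfl, he, hx⟩ := List.map_eq_cons_iff.1 hy
  exact ⟨c, e, x, rfl, hc, he, hx⟩

theorem eq_of_map_eq {M N : Type*} {v : M → N} {P : Set M} (hinj : Set.InjOn v P) {a b : List M}
    (ha : ∀ x ∈ a, x ∈ P) (hb : ∀ x ∈ b, x ∈ P) (h : a.map v = b.map v) : a = b := by
  induction a generalizing b with
  | nil => simpa using h.symm
  | cons x a ih =>
    cases b with
    | nil => simp at h
    | cons y b =>
      simp only [List.forall_mem_cons, List.map_cons, List.cons.injEq] at *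
      exact ⟨hinj ha.1 hb.1 h.1, ih ha.2 hb.2 h.2⟩

/-- Modalities in `P` are compared by the ordinals `v x`. Then of two normal worms with modalities
in `P`, the one of smaller weight is below the other with respect to every modality that is a lower
bound of all modalities of both. -/
theorem WormSystem.form_le_dia_form {M F : Type*} (S : WormSystem M F) (v : M → Ordinal.{0})
    (P : Set M) (hlt : ∀ x ∈ P, ∀ y ∈ P, v x < v y → S.lt x y) (hinj : Set.InjOn v P)
    {a b : List M} (ha : ∀ x ∈ a, x ∈ P) (hb : ∀ x ∈ b, x ∈ P)
    (hna : IsNormalWorm (a.map v)) (hnb : IsNormalWorm (b.map v))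
    {β : Ordinal.{0}} (hβa : ∀ x ∈ a, β ≤ v x) (hβb : ∀ x ∈ b, β ≤ v x)
    (h : weight β (a.map v) < weight β (b.map v)) {d : M} (hd : d ∈ P)
    (hda : ∀ x ∈ a, v d ≤ v x) (hdb : ∀ x ∈ b, v d ≤ v x) :
    S.le (S.form b) (S.dia d (S.form a)) := by
  induction hn : a.length + b.length using Nat.strong_induction_on generalizing a b β d with
  | _ n ih =>
  have hmono : ∀ x ∈ P, ∀ y ∈ P, v x ≤ v y → S.lt x y ∨ x = y := fun x hx y hy hxy =>
    hxy.lt_or_eq.imp (hlt x hx y hy) (hinj hx hy)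
  have hb0 : b ≠ [] := by
    rintro rfl
    simp at h
  obtain ⟨U, α, V, hs⟩ := exists_splits (A := (a ++ b).map v) (by simp [hb0])
  obtain ⟨u, e, w, huw, rfl, rfl, rfl⟩ := exists_splits_map hs
  have hle : ∀ x ∈ a ++ b, v e ≤ v x := fun x hx => hs.le_of_mem (List.mem_map_of_mem hx)
  have he : e ∈ a ++ b := by simp [huw]
  have heP : e ∈ P := (List.mem_append.1 he).elim (ha e) (hb e)
  have hea : ∀ x ∈ a, v e ≤ v x := fun x hx => hle x (List.mem_append_left _ hx)
  have heb : ∀ x ∈ b, v e ≤ v x := fun x hx => hle x (List.mem_append_right _ hx)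
  have hde : v d ≤ v e := (List.mem_append.1 he).elim (hda e) (hdb e)
  have hβe : β ≤ v e := (List.mem_append.1 he).elim (hβa e) (hβb e)
  rw [weight_lt_weight_iff hβe (by simpa using hea) (by simpa using heb)] at h
  -- it is enough to treat the least modality `e` of both worms
  suffices hgoal : S.le (S.form b) (S.dia e (S.form a)) by
    rcases hmono d hd e heP hde with hd' | rfl
    exacts [S.trans hgoal (S.dia_anti _ hd'), hgoal]
  clear hda hdb hde hβe hβa hβb hd d hs huw
  have hlt' : ∀ {c : List M}, (∀ x ∈ c, x ∈ P) → (∀ x ∈ c.map v, v e < x) →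
      ∀ y ∈ c, S.lt e y := fun hc h y hy => hlt e heP y (hc y hy) (h _ (List.mem_map_of_mem hy))
  -- the induction hypothesis for worms with all modalities above `e`
  have ih' : ∀ {c d : List M}, c.length + d.length < n → (∀ x ∈ c, x ∈ P) → (∀ x ∈ d, x ∈ P) →
      IsNormalWorm (c.map v) → IsNormalWorm (d.map v) → (∀ x ∈ c.map v, v e < x) →
      (∀ x ∈ d.map v, v e < x) → weight (v e + 1) (c.map v) < weight (v e + 1) (d.map v) →
      ∃ y, S.lt e y ∧ S.le (S.form d) (S.dia y (S.form c)) := by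
    intro c d hl hc hd hnc hnd hec hed hw
    have hd0 : d ≠ [] := by
      rintro rfl
      simp at hw
    obtain ⟨U, α, V, hs⟩ := exists_splits (A := (c ++ d).map v) (by simp [hd0])
    obtain ⟨u, y, w, huw, rfl, rfl, rfl⟩ := exists_splits_map hs
    have hle : ∀ x ∈ c ++ d, v y ≤ v x := fun x hx => hs.le_of_mem (List.mem_map_of_mem hx)
    have hy : y ∈ c ++ d := by simp [huw]
    have hyP : y ∈ P := (List.mem_append.1 hy).elim (hc y) (hd y)
    refine ⟨y, hlt e heP y hyP ?_, ?_⟩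
    · exact (List.mem_append.1 hy).elim (fun h => hec _ (List.mem_map_of_mem h))
        (fun h => hed _ (List.mem_map_of_mem h))
    · exact ih _ hl hc hd hnc hnd
        (fun x hx => Order.add_one_le_of_lt (hec _ (List.mem_map_of_mem hx)))
        (fun x hx => Order.add_one_le_of_lt (hed _ (List.mem_map_of_mem hx))) hw hyP
        (fun x hx => hle x (List.mem_append_left _ hx))
        (fun x hx => hle x (List.mem_append_right _ hx)) rfl
  rcases forall_lt_or_splits (A := b.map v) (by simpa using heb) with hB | ⟨D, Y, hsb⟩
  -- `e` occurs in `a = c ⟨e⟩ x` only: `b` is above both `c` and `x`, hence above `a`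
  · rcases forall_lt_or_splits (A := a.map v) (by simpa using hea) with hA | ⟨C, X, hsa⟩
    · exact ((List.mem_append.1 he).elim (fun h => hA _ (List.mem_map_of_mem h))
        (fun h => hB _ (List.mem_map_of_mem h))).false.elim
    obtain ⟨c, f, x, rfl, rfl, hf, rfl⟩ := exists_splits_map hsa
    obtain ⟨h1, h2, -⟩ := hna.of_splits hsa
    have hw := weight_append_cons hsa.lt hsa.le
    rw [hsa.eq, hw] at h
    simp only [List.mem_append, List.mem_cons, or_imp, forall_and, forall_eq] at ha hea
    obtain rfl : f = e := hinj ha.2.1 heP hf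
    simp only [List.length_append, List.length_cons] at hn
    have hcw : weight (v f + 1) (c.map v) < weight (v f + 1) (b.map v) := by
      rw [← opow_lt_opow_iff_right one_lt_omega0, ← one_add_weight hB]
      calc ω ^ weight (v f + 1) (c.map v)
          ≤ weight (v f) (x.map v) + ω ^ weight (v f + 1) (c.map v) :=
            le_add_of_nonneg_left bot_le
        _ < weight (v f) (b.map v) := h
        _ ≤ 1 + weight (v f) (b.map v) := le_add_of_nonneg_left bot_le
    obtain ⟨y, hy, hyc⟩ := ih' (by omega) ha.1 hb h1 hnb hsa.lt hB hcw
    refine S.le_dia_form_append_cons hy (hlt' ha.1 hsa.lt) hyc ?_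
    refine ih (x.length + b.length) (by omega) ha.2.2 hb h2 hnb hea.2.2 heb ?_ heP hea.2.2 heb rfl
    exact (le_add_of_nonneg_right bot_le).trans_lt h
  obtain ⟨g, f, y, rfl, rfl, hf, rfl⟩ := exists_splits_map hsb
  obtain ⟨h4, h5, h6⟩ := hnb.of_splits hsb
  simp only [List.mem_append, List.mem_cons, or_imp, forall_and, forall_eq] at hb heb
  obtain rfl : f = e := hinj hb.2.1 heP hf
  simp only [List.length_append, List.length_cons] at hn
  have hdrop : S.le (S.form (g ++ f :: y)) (S.dia f (S.form y)) := by
    rw [S.form_append]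
    exact S.dias_dia_le (fun z hz => Or.inl (hlt' hb.1 hsb.lt z hz)) _
  -- `b = g ⟨e⟩ y`: either `y` is already at least `a`, or the block `g` decides the comparison
  rcases lt_or_ge (weight (v f) (y.map v)) (weight (v f) (a.map v)) with hya | hay
  · rcases forall_lt_or_splits (A := a.map v) (by simpa using hea) with hA | ⟨C, X, hsa⟩
    · -- `1 + weight a` is a power of `ω`, which cannot lie between the partial sums for `y` and `b`
      rw [hsb.eq, weight_append_cons hsb.lt hsb.le] at h
      rw [← add_lt_add_iff_left 1, one_add_weight hA] at hya
      rw [← add_lt_add_iff_left 1, one_add_weight hA, ← add_assoc] at h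
      exact (h.not_gt (add_opow_lt_opow_of_dvd (by simp) (h5.opow_dvd hsb.le h6) hya)).elim
    · obtain ⟨c, f', x, rfl, rfl, hf, rfl⟩ := exists_splits_map hsa
      obtain ⟨h1, h2, -⟩ := hna.of_splits hsa
      have hx : weight (v f) (x.map v) < weight (v f) ((c ++ f' :: x).map v) := by
        rw [hsa.eq, weight_append_cons hsa.lt hsa.le]
        exact lt_add_of_pos_right _ (opow_pos _ omega0_pos)
      have hxb := hx.trans h
      rw [hsa.eq, weight_append_cons hsa.lt hsa.le] at hya h
      rw [hsb.eq, weight_append_cons hsb.lt hsb.le] at h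
      simp only [List.mem_append, List.mem_cons, or_imp, forall_and, forall_eq] at ha hea
      obtain rfl : f' = f := hinj ha.2.1 heP hf
      simp only [List.length_append, List.length_cons] at hn
      obtain ⟨z, hz, hzc⟩ := ih' (by omega) ha.1 hb.1 h1 h4 hsa.lt hsb.lt
        (lt_of_add_opow_lt_add_opow h hya)
      refine S.le_dia_form_append_cons hz (hlt' ha.1 hsa.lt)
        (S.trans (S.form_append_le g _) hzc) ?_
      have hb' : ∀ x ∈ g ++ f' :: y, x ∈ P ∧ v f' ≤ v x := by
        simp only [List.mem_append, List.mem_cons, or_imp, forall_and, forall_eq]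
        tauto
      exact ih (x.length + (g ++ f' :: y).length) (by simp; omega) ha.2.2 (fun z hz => (hb' z hz).1)
        h2 hnb hea.2.2 (fun z hz => (hb' z hz).2) hxb heP hea.2.2 (fun z hz => (hb' z hz).2) rfl
  · refine S.trans hdrop ?_
    rcases hay.lt_or_eq with hlt | heq
    · exact S.trans (S.dia_mono f (ih (a.length + y.length) (by omega) ha hb.2.2 hna h5 hea heb.2.2
        hlt heP hea heb.2.2 rfl)) (S.dia_dia _ _)
    · have : a = y := eq_of_map_eq hinj ha hb.2.2
        (hna.eq_of_weight_eq h5 (by simpa using hea) (by simpa using heb.2.2) heq)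
      rw [this]
      exact S.refl _

/-! ### Irreflexivity of the consistency ordering -/

theorem RC.inF {Λ : Ordinal.{0}} {φ ψ : RCForm} (h : RC Λ φ ψ) : φ.InF Λ ∧ ψ.InF Λ := by
  induction h with
  | refl φ h => exact ⟨h, h⟩
  | top φ h => exact ⟨h, trivial⟩
  | and_left φ ψ h h' => exact ⟨⟨h, h'⟩, h⟩
  | and_right φ ψ h h' => exact ⟨⟨h, h'⟩, h'⟩
  | dia_dia α φ hα h => exact ⟨⟨hα, hα, h⟩, hα, h⟩
  | dia_mono α β φ hα hβ h => exact ⟨⟨hα, h⟩, hβ.trans hα, h⟩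
  | dia_and α β φ ψ hα hβ h h' =>
    exact ⟨⟨⟨hα, h⟩, hβ.trans hα, h'⟩, hα, h, hβ.trans hα, h'⟩
  | and_intro _ _ ih1 ih2 => exact ⟨ih1.1, ih1.2, ih2.2⟩
  | cut _ _ ih1 ih2 => exact ⟨ih1.1, ih2.2⟩
  | nec α hα _ ih => exact ⟨⟨hα, ih.1⟩, hα, ih.2⟩

/-- The exponent of the last term of the Cantor normal form of `x` (and a junk value for `x = 0`,
where the set of exponents is unbounded). -/
noncomputable def lastExp (x : Ordinal.{0}) : Ordinal.{0} := sSup {w : Ordinal.{0} | ω ^ w ∣ x}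

theorem lastExp_add_opow (z w : Ordinal.{0}) : lastExp (z + ω ^ w) = w := by
  refine IsGreatest.csSup_eq ⟨?_, fun c hc => le_of_opow_dvd_add_opow hc⟩
  have hp : (ω : Ordinal.{0}) ^ w ≠ 0 := (opow_pos w omega0_pos).ne'
  refine ⟨z / ω ^ w + 1, ?_⟩
  conv_lhs => rw [← Ordinal.div_add_mod z (ω ^ w)]
  rw [add_assoc, add_omega0_opow (Ordinal.mod_lt _ hp), mul_add_one]

theorem add_opow_lt_of_lt_lastExp {w x z : Ordinal.{0}} (hz : z < x) (hw : w < lastExp x) :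
    z + ω ^ w < x := by
  have hne : {w : Ordinal.{0} | ω ^ w ∣ x}.Nonempty := ⟨0, by simp⟩
  obtain ⟨v, hv, hwv⟩ := exists_lt_of_lt_csSup hne hw
  exact add_opow_lt_of_dvd hv hwv hz

/-- The accessibility relation for the `n`-th modality in a Kripke model on the ordinals: `x`
sees `y` if the iterated last exponents of `y` are at most those of `x` before stage `n`, and
smaller at stage `n`. -/
def Sees (n : ℕ) (x y : Ordinal.{0}) : Prop :=
  (∀ m < n, lastExp^[m] y ≤ lastExp^[m] x) ∧ lastExp^[n] y < lastExp^[n] x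

theorem Sees.trans {n : ℕ} {x y z : Ordinal.{0}} (h : Sees n x y) (h' : Sees n y z) :
    Sees n x z :=
  ⟨fun m hm => (h'.1 m hm).trans (h.1 m hm), h'.2.trans h.2⟩

theorem Sees.anti {k n : ℕ} {x y : Ordinal.{0}} (h : Sees n x y) (hk : k ≤ n) : Sees k x y := by
  rcases hk.eq_or_lt with rfl | hk
  · exact h
  refine ⟨fun m hm => h.1 m (hm.trans hk), (h.1 k hk).lt_of_ne fun he => ?_⟩
  obtain ⟨r, rfl⟩ := Nat.exists_eq_add_of_le' hk.le
  have := h.2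
  rw [Function.iterate_add_apply, Function.iterate_add_apply, he] at this
  exact this.false

theorem Sees.lt {n : ℕ} {x y : Ordinal.{0}} (h : Sees n x y) : y < x := by
  simpa using (h.anti (Nat.zero_le n)).2

theorem sees_succ_iff {n : ℕ} {x y : Ordinal.{0}} :
    Sees (n + 1) x y ↔ y ≤ x ∧ Sees n (lastExp x) (lastExp y) := by
  constructor
  · intro h
    exact ⟨h.1 0 (Nat.succ_pos n), fun m hm => h.1 (m + 1) (Nat.succ_lt_succ hm), h.2⟩
  · rintro ⟨h1, h2⟩
    refine ⟨fun m hm => ?_, h2.2⟩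
    cases m with
    | zero => exact h1
    | succ m => exact h2.1 m (Nat.lt_of_succ_lt_succ hm)

/-- The frame property behind `⟨α⟩φ ∧ ⟨β⟩ψ ⊢ ⟨α⟩(φ ∧ ⟨β⟩ψ)`: if `x` sees `y` at stage `n` and `z`
at an earlier stage `k`, then `y` can be enlarged to a point `t` that `x` still sees at stage `n`
and that itself sees `z` at stage `k`. -/
theorem exists_sees_sees {n k : ℕ} (hk : k < n) {x y z : Ordinal.{0}} (hy : Sees n x y)
    (hz : Sees k x z) :
    ∃ t, (∀ m, lastExp^[m] y ≤ lastExp^[m] t) ∧ Sees n x t ∧ Sees k t z := by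
  induction n generalizing k x y z with
  | zero => omega
  | succ n ih =>
    obtain ⟨w, h1, h2, h3⟩ : ∃ w, (∀ m, lastExp^[m] (lastExp y) ≤ lastExp^[m] w) ∧
        Sees n (lastExp x) w ∧ ∀ k', k = k' + 1 → Sees k' w (lastExp z) := by
      have hy' := (sees_succ_iff.1 hy).2
      cases k with
      | zero => exact ⟨lastExp y, fun _ => le_rfl, hy', by simp⟩
      | succ k =>
        obtain ⟨w, h1, h2, h3⟩ := ih (Nat.lt_of_succ_lt_succ hk) hy' (sees_succ_iff.1 hz).2
        exact ⟨w, h1, h2, fun k' hk' => Nat.succ_injective hk' ▸ h3⟩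
    have hlt := lt_add_of_pos_right (max y z) (opow_pos w omega0_pos)
    refine ⟨max y z + ω ^ w, fun m => ?_, sees_succ_iff.2 ⟨?_, ?_⟩, ?_⟩
    · cases m with
      | zero => exact ((le_max_left y z).trans_lt hlt).le
      | succ m => simpa only [Function.iterate_succ_apply, lastExp_add_opow] using h1 m
    · exact (add_opow_lt_of_lt_lastExp (max_lt hy.lt hz.lt) h2.lt).le
    · rwa [lastExp_add_opow]
    · cases k with
      | zero => exact ⟨by simp, by simpa using (le_max_right y z).trans_lt hlt⟩
      | succ k =>
        refine sees_succ_iff.2 ⟨((le_max_right y z).trans_lt hlt).le, ?_⟩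
        rw [lastExp_add_opow]
        exact h3 k rfl

theorem exists_sees (n : ℕ) (y : Ordinal.{0}) : ∃ x, Sees n x y := by
  induction n generalizing y with
  | zero => exact ⟨y + 1, by simp, by simp⟩
  | succ n ih =>
    obtain ⟨w, hw⟩ := ih (lastExp y)
    exact ⟨y + ω ^ w, sees_succ_iff.2 ⟨le_add_of_nonneg_right bot_le, by rwa [lastExp_add_opow]⟩⟩

/-- Truth of a formula at an ordinal, where the modality `⟨α⟩` is interpreted by `Sees (j α)` and
all variables are true. -/
def Sat (j : Ordinal.{0} → ℕ) : RCForm → Ordinal.{0} → Prop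
  | .top, _ => True
  | .var _, _ => True
  | .and φ ψ, x => Sat j φ x ∧ Sat j ψ x
  | .dia α φ, x => ∃ y, Sees (j α) x y ∧ Sat j φ y

theorem Sat.mono {j : Ordinal.{0} → ℕ} {φ : RCForm} {x y : Ordinal.{0}}
    (h : ∀ m, lastExp^[m] x ≤ lastExp^[m] y) (hx : Sat j φ x) : Sat j φ y := by
  induction φ with
  | top => trivial
  | var n => trivial
  | and φ ψ ih1 ih2 => exact ⟨ih1 hx.1, ih2 hx.2⟩
  | dia α φ ih =>
    obtain ⟨z, hz, hφ⟩ := hx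
    exact ⟨z, ⟨fun m hm => (hz.1 m hm).trans (h m), hz.2.trans_le (h _)⟩, hφ⟩

/-- The number of elements of `G` below `α`. -/
noncomputable def countBelow (G : Finset Ordinal.{0}) (α : Ordinal.{0}) : ℕ :=
  (G.filter (· < α)).card

theorem countBelow_lt {G : Finset Ordinal.{0}} {α β : Ordinal.{0}} (hβ : β ∈ G) (h : β < α) :
    countBelow G β < countBelow G α := by
  apply Finset.card_lt_card
  refine (Finset.ssubset_iff_of_subset ?_).2 ⟨β, by simp [hβ, h], by simp⟩
  intro x
  simp only [Finset.mem_filter]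
  exact fun hx => ⟨hx.1, hx.2.trans h⟩

/-- Soundness of the reflection calculus in the Kripke model, where modalities are numbered by a
finite set of ordinals that is large enough for the given derivation. -/
theorem RC.exists_sat {Λ : Ordinal.{0}} {φ ψ : RCForm} (h : RC Λ φ ψ) :
    ∃ F : Finset Ordinal.{0}, ∀ G, F ⊆ G → ∀ x, Sat (countBelow G) φ x →
      Sat (countBelow G) ψ x := by
  classical
  induction h with
  | refl φ _ => exact ⟨∅, fun G _ x h => h⟩
  | top φ _ => exact ⟨∅, fun G _ x _ => trivial⟩
  | and_left φ ψ _ _ => exact ⟨∅, fun G _ x h => h.1⟩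
  | and_right φ ψ _ _ => exact ⟨∅, fun G _ x h => h.2⟩
  | dia_dia α φ _ _ =>
    exact ⟨∅, fun G _ x ⟨y, hy, z, hz, h⟩ => ⟨z, hy.trans hz, h⟩⟩
  | dia_mono α β φ _ hβ _ =>
    refine ⟨{β}, fun G hG x ⟨y, hy, h⟩ => ⟨y, hy.anti ?_, h⟩⟩
    exact (countBelow_lt (by simpa using hG) hβ).le
  | dia_and α β φ ψ _ hβ _ _ =>
    refine ⟨{β}, fun G hG x ⟨⟨y, hy, h⟩, z, hz, h'⟩ => ?_⟩
    obtain ⟨t, h1, h2, h3⟩ := exists_sees_sees (countBelow_lt (by simpa using hG) hβ) hy hz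
    exact ⟨t, h2, h.mono h1, z, h3, h'⟩
  | and_intro _ _ ih1 ih2 =>
    obtain ⟨F1, h1⟩ := ih1
    obtain ⟨F2, h2⟩ := ih2
    exact ⟨F1 ∪ F2, fun G hG x h => ⟨h1 G (Finset.union_subset_left hG) x h,
      h2 G (Finset.union_subset_right hG) x h⟩⟩
  | cut _ _ ih1 ih2 =>
    obtain ⟨F1, h1⟩ := ih1
    obtain ⟨F2, h2⟩ := ih2
    exact ⟨F1 ∪ F2, fun G hG x h => h2 G (Finset.union_subset_right hG) x
      (h1 G (Finset.union_subset_left hG) x h)⟩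
  | nec α _ _ ih =>
    obtain ⟨F, hF⟩ := ih
    exact ⟨F, fun G hG x ⟨y, hy, h⟩ => ⟨y, hy, hF G hG y h⟩⟩

theorem exists_sat_toForm (j : Ordinal.{0} → ℕ) (A : Worm) : ∃ x, Sat j A.toForm x := by
  induction A with
  | nil => exact ⟨0, trivial⟩
  | cons α A ih =>
    obtain ⟨y, hy⟩ := ih
    obtain ⟨x, hx⟩ := exists_sees (j α) y
    exact ⟨x, y, hx, hy⟩

theorem not_wlt_self (Λ : Ordinal.{0}) (A : Worm) : ¬ wlt Λ 0 A A := by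
  intro h
  obtain ⟨F, hF⟩ := RC.exists_sat h
  obtain ⟨x, hx⟩ := exists_sat_toForm (countBelow F) A
  induction x using WellFoundedLT.induction with
  | ind x ih =>
    obtain ⟨y, hy, hA⟩ := hF F subset_rfl x hx
    exact ih y hy.lt hA

/-! ### Normal forms in the reflection calculus -/

theorem inF_toForm_iff {Λ : Ordinal.{0}} {A : Worm} :
    (Worm.toForm A).InF Λ ↔ ∀ x ∈ A, x < Λ := by
  induction A with
  | nil => simp [Worm.toForm, RCForm.InF]
  | cons α A ih => simp [Worm.toForm, RCForm.InF, ih]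

/-- The reflection calculus as a worm system; formulas and modalities are restricted to those of
`𝔽_Λ`. -/
def rcSystem (Λ : Ordinal.{0}) :
    WormSystem {α : Ordinal.{0} // α < Λ} {φ : RCForm // φ.InF Λ} where
  top := ⟨.top, trivial⟩
  and φ ψ := ⟨.and φ.1 ψ.1, φ.2, ψ.2⟩
  dia α φ := ⟨.dia α.1 φ.1, α.2, φ.2⟩
  le φ ψ := RC Λ φ.1 ψ.1
  lt α β := α.1 < β.1
  refl φ := .refl _ φ.2
  trans := .cut
  le_top φ := .top _ φ.2
  and_left φ ψ := .and_left _ _ φ.2 ψ.2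
  and_right φ ψ := .and_right _ _ φ.2 ψ.2
  le_and := .and_intro
  dia_mono α _ _ h := .nec _ α.2 h
  dia_anti {_ y} φ h := .dia_mono _ _ _ y.2 h φ.2
  dia_dia α φ := .dia_dia _ _ α.2 φ.2
  dia_and {_ y} φ ψ h := .dia_and _ _ _ _ y.2 h φ.2 ψ.2

theorem rcSystem_form_val {Λ : Ordinal.{0}} (a : List {α : Ordinal.{0} // α < Λ}) :
    ((rcSystem Λ).form a).1 = Worm.toForm (a.map Subtype.val) := by
  induction a with
  | nil => rfl
  | cons x a ih => exact congrArg (RCForm.dia x.1) ih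

/-- The case of `WormSystem.form_le_dia_form` for the reflection calculus. -/
theorem wlt_of_weight_lt {Λ : Ordinal.{0}} {A B : Worm} (hA : IsNormalWorm A)
    (hB : IsNormalWorm B) (hAΛ : ∀ x ∈ A, x < Λ) (hBΛ : ∀ x ∈ B, x < Λ) {μ : Ordinal.{0}}
    (hμA : ∀ x ∈ A, μ ≤ x) (hμB : ∀ x ∈ B, μ ≤ x) (h : weight μ A < weight μ B) :
    wlt Λ μ A B := by
  obtain ⟨y, hy⟩ : ∃ y, y ∈ B := List.exists_mem_of_ne_nil B (by rintro rfl; simp at h)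
  lift A to List {α : Ordinal.{0} // α < Λ} using hAΛ
  lift B to List {α : Ordinal.{0} // α < Λ} using hBΛ
  simp only [List.forall_mem_map] at hμA hμB
  have hμ : μ < Λ := by
    obtain ⟨z, hz, rfl⟩ := List.mem_map.1 hy
    exact (hμB z hz).trans_lt z.2
  have := (rcSystem Λ).form_le_dia_form Subtype.val Set.univ (fun _ _ _ _ h => h)
    Subtype.val_injective.injOn (by simp) (by simp) hA hB hμA hμB h (d := ⟨μ, hμ⟩) trivial hμA hμB
  have h2 : RC Λ ((rcSystem Λ).form B).1 (.dia μ ((rcSystem Λ).form A).1) := this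
  rwa [rcSystem_form_val, rcSystem_form_val] at h2

namespace WormSystem

variable {M F : Type*} (S : WormSystem M F)

/-- Mutual derivability of worms. -/
def Equiv (a b : List M) : Prop := S.le (S.form a) (S.form b) ∧ S.le (S.form b) (S.form a)

variable {S}

theorem Equiv.refl (a : List M) : S.Equiv a a := ⟨S.refl _, S.refl _⟩

theorem Equiv.trans {a b c : List M} (h : S.Equiv a b) (h' : S.Equiv b c) : S.Equiv a c :=
  ⟨S.trans h.1 h'.1, S.trans h'.2 h.2⟩

theorem Equiv.cons {a b : List M} (h : S.Equiv a b) (x : M) : S.Equiv (x :: a) (x :: b) :=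
  ⟨S.dia_mono x h.1, S.dia_mono x h.2⟩

theorem form_append_cons_le {x : M} {a : List M} (h : ∀ y ∈ a, S.lt x y) (b : List M) :
    S.le (S.form (a ++ x :: b)) (S.dia x (S.form b)) := by
  rw [form_append]
  exact S.dias_dia_le (fun y hy => Or.inl (h y hy)) _

theorem Equiv.append_cons {a b : List M} (h : S.Equiv a b) {x : M} (ha : ∀ y ∈ a, S.lt x y)
    (hb : ∀ y ∈ b, S.lt x y) (c : List M) : S.Equiv (a ++ x :: c) (b ++ x :: c) :=
  ⟨S.le_form_append_cons hb (S.trans (S.form_append_le a _) h.1) (form_append_cons_le ha c),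
    S.le_form_append_cons ha (S.trans (S.form_append_le b _) h.2) (form_append_cons_le hb c)⟩

end WormSystem

/-- A block `d` that is smaller than its left neighbour `c` is absorbed. -/
theorem equiv_absorb {M F : Type*} {S : WormSystem M F} {x z : M} {c d y : List M}
    (hc : ∀ t ∈ c, S.lt x t) (hd : ∀ t ∈ d, S.lt x t) (hz : S.lt x z)
    (h : S.le (S.form c) (S.dia z (S.form d))) :
    S.Equiv (c ++ x :: (d ++ x :: y)) (c ++ x :: y) := by
  constructor
  · refine S.le_form_append_cons hc (S.form_append_le c _) ?_
    refine S.trans (WormSystem.form_append_cons_le hc _) ?_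
    exact S.trans (S.dia_mono x (WormSystem.form_append_cons_le hd y)) (S.dia_dia _ _)
  · refine S.le_form_append_cons hc (S.form_append_le c _) ?_
    exact S.le_dia_form_append_cons hz hd (S.trans (S.form_append_le c _) h)
      (WormSystem.form_append_cons_le hc y)

/-- Joining two normal worms by a modality `e` that is smaller than those of the first and at most
those of the second: blocks of the second worm are absorbed until one is not smaller than `c`. -/
theorem exists_normal_append_cons {Λ : Ordinal.{0}} {c x : List {α : Ordinal.{0} // α < Λ}}
    {e : {α : Ordinal.{0} // α < Λ}} (hc : IsNormalWorm (c.map Subtype.val))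
    (hx : IsNormalWorm (x.map Subtype.val)) (hec : ∀ t ∈ c, e.1 < t.1) (hex : ∀ t ∈ x, e.1 ≤ t.1) :
    ∃ b, IsNormalWorm (b.map Subtype.val) ∧ (rcSystem Λ).Equiv (c ++ e :: x) b ∧
      ∀ t ∈ b, e.1 ≤ t.1 := by
  induction hn : x.length using Nat.strong_induction_on generalizing x with
  | _ n ih =>
  have hec' : ∀ t ∈ c.map Subtype.val, e.1 < t := List.forall_mem_map.2 hec
  have hex' : ∀ t ∈ x.map Subtype.val, e.1 ≤ t := List.forall_mem_map.2 hex
  rcases le_or_gt (weight (e.1 + 1) (c.map Subtype.val))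
    (weight (e.1 + 1) ((x.map Subtype.val).takeWhile (e.1 < ·))) with hw | hw
  · refine ⟨c ++ e :: x, ?_, .refl _, ?_⟩
    · simpa using IsNormalWorm.append hec' hex' hc hx hw
    · simp only [List.mem_append, List.mem_cons]
      rintro t (ht | rfl | ht)
      exacts [(hec t ht).le, le_rfl, hex t ht]
  obtain ⟨y, hy⟩ : ∃ y, y ∈ c := List.exists_mem_of_ne_nil c (by rintro rfl; simp at hw)
  have heΛ : e.1 + 1 < Λ := (Order.add_one_le_of_lt (hec y hy)).trans_lt y.2
  have comp : ∀ {d : List {α : Ordinal.{0} // α < Λ}}, IsNormalWorm (d.map Subtype.val) →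
      (∀ t ∈ d, e.1 < t.1) →
      weight (e.1 + 1) (d.map Subtype.val) < weight (e.1 + 1) (c.map Subtype.val) →
      (rcSystem Λ).le ((rcSystem Λ).form c)
        ((rcSystem Λ).dia ⟨e.1 + 1, heΛ⟩ ((rcSystem Λ).form d)) := by
    intro d hd hed hdw
    exact (rcSystem Λ).form_le_dia_form Subtype.val Set.univ (fun _ _ _ _ h => h)
      Subtype.val_injective.injOn (by simp) (by simp) hd hc
      (fun t ht => Order.add_one_le_of_lt (hed t ht))
      (fun t ht => Order.add_one_le_of_lt (hec t ht)) hdw trivial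
      (fun t ht => Order.add_one_le_of_lt (hed t ht))
      (fun t ht => Order.add_one_le_of_lt (hec t ht))
  have hlt : (rcSystem Λ).lt e ⟨e.1 + 1, heΛ⟩ := Order.lt_add_one_iff.2 le_rfl
  rcases forall_lt_or_splits hex' with hX | ⟨D, Y, hs⟩
  · rw [takeWhile_lt_eq_self hX] at hw
    refine ⟨c, hc, ⟨(rcSystem Λ).form_append_le c _, ?_⟩, fun t ht => (hec t ht).le⟩
    exact (rcSystem Λ).le_form_append_cons hec ((rcSystem Λ).refl _)
      ((rcSystem Λ).trans (comp hx (List.forall_mem_map.1 hX) hw) ((rcSystem Λ).dia_anti _ hlt))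
  · obtain ⟨d, f, y, rfl, rfl, hf, rfl⟩ := exists_splits_map hs
    obtain rfl : f = e := Subtype.ext hf
    obtain ⟨h1, h2, -⟩ := hx.of_splits hs
    have hed : ∀ t ∈ d, f.1 < t.1 := List.forall_mem_map.1 hs.lt
    rw [hs.eq, takeWhile_lt_append_cons hs.lt] at hw
    obtain ⟨b, hb, hbe, hbf⟩ := ih y.length (by simp [← hn]; omega) h2
      (List.forall_mem_map.1 hs.le) rfl
    exact ⟨b, hb, (equiv_absorb hec hed hlt (comp h1 hed hw)).trans hbe, hbf⟩

/-- Prefixing a normal worm with a modality `e`. If its least modality `f` is smaller than `e`, only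
its first block changes; the bound on the modalities shows that these stay above `f`. -/
theorem exists_normal_cons {Λ : Ordinal.{0}} (e : {α : Ordinal.{0} // α < Λ})
    {a : List {α : Ordinal.{0} // α < Λ}} (ha : IsNormalWorm (a.map Subtype.val)) :
    ∃ b, IsNormalWorm (b.map Subtype.val) ∧ (rcSystem Λ).Equiv (e :: a) b ∧
      ∀ β : Ordinal.{0}, β ≤ e.1 → (∀ t ∈ a, β ≤ t.1) → ∀ t ∈ b, β ≤ t.1 := by
  induction hn : a.length using Nat.strong_induction_on generalizing a with
  | _ n ih =>
  have small : (∀ t ∈ a, e.1 ≤ t.1) → ∃ b, IsNormalWorm (b.map Subtype.val) ∧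
      (rcSystem Λ).Equiv (e :: a) b ∧
      ∀ β : Ordinal.{0}, β ≤ e.1 → (∀ t ∈ a, β ≤ t.1) → ∀ t ∈ b, β ≤ t.1 := by
    intro he
    refine ⟨e :: a, ?_, .refl _, ?_⟩
    · exact IsNormalWorm.append (C := []) (by simp) (List.forall_mem_map.2 he) .nil ha (by simp)
    · intro β h1 h2
      exact List.forall_mem_cons.2 ⟨h1, h2⟩
  by_cases h0 : a = []
  · exact small (by simp [h0])
  obtain ⟨C, α, X, hs⟩ := exists_splits (A := a.map Subtype.val)
    (List.map_eq_nil_iff.not.2 h0)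
  rcases le_or_gt e.1 α with hle | hlt
  · exact small fun t ht => hle.trans (hs.le_of_mem (List.mem_map_of_mem ht))
  obtain ⟨c, f, x, rfl, rfl, rfl, rfl⟩ := exists_splits_map hs
  obtain ⟨h1, h2, -⟩ := ha.of_splits hs
  have hfc : ∀ t ∈ c, f.1 < t.1 := List.forall_mem_map.1 hs.lt
  obtain ⟨c', h3, h4, h5⟩ := ih c.length (by simp [← hn]) h1 rfl
  have hfc' : ∀ t ∈ c', f.1 < t.1 := fun t ht => Order.add_one_le_iff.1
    (h5 (f.1 + 1) (Order.add_one_le_of_lt hlt) (fun t ht => Order.add_one_le_of_lt (hfc t ht)) t ht)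
  obtain ⟨b, h6, h7, h8⟩ := exists_normal_append_cons h3 h2 hfc' (List.forall_mem_map.1 hs.le)
  refine ⟨b, h6, (h4.append_cons ?_ hfc' x).trans h7, ?_⟩
  · exact List.forall_mem_cons.2 ⟨hlt, hfc⟩
  · intro β _ hβ t ht
    exact (hβ f (by simp)).trans (h8 t ht)

/-- Every worm is equivalent to a normal one. -/
theorem exists_normal_equiv {Λ : Ordinal.{0}} (a : List {α : Ordinal.{0} // α < Λ}) :
    ∃ b, IsNormalWorm (b.map Subtype.val) ∧ (rcSystem Λ).Equiv a b := by
  induction a with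
  | nil => exact ⟨[], .nil, .refl _⟩
  | cons e a ih =>
    obtain ⟨b, h1, h2⟩ := ih
    obtain ⟨c, h3, h4, -⟩ := exists_normal_cons e h1
    exact ⟨c, h3, (h2.cons e).trans h4⟩

theorem exists_isNormalWorm_equiv {Λ : Ordinal.{0}} {A : Worm} (hA : ∀ x ∈ A, x < Λ) :
    ∃ B, IsNormalWorm B ∧ (∀ x ∈ B, x < Λ) ∧ RC Λ (Worm.toForm A) (Worm.toForm B) ∧
      RC Λ (Worm.toForm B) (Worm.toForm A) := by
  lift A to List {α : Ordinal.{0} // α < Λ} using hA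
  obtain ⟨b, h1, h2, h3⟩ := exists_normal_equiv A
  refine ⟨_, h1, by simp +contextual, ?_, ?_⟩
  · have h : RC Λ ((rcSystem Λ).form A).1 ((rcSystem Λ).form b).1 := h2
    rwa [rcSystem_form_val, rcSystem_form_val] at h
  · have h : RC Λ ((rcSystem Λ).form b).1 ((rcSystem Λ).form A).1 := h3
    rwa [rcSystem_form_val, rcSystem_form_val] at h

/-! ### Order types of worms -/

theorem wlt.lt_left {Λ μ : Ordinal.{0}} {A B : Worm} (h : wlt Λ μ B A) : ∀ x ∈ B, x < Λ :=
  inF_toForm_iff.1 (RC.inF h).2.2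

theorem wlt.lt_right {Λ μ : Ordinal.{0}} {A B : Worm} (h : wlt Λ μ B A) : ∀ x ∈ A, x < Λ :=
  inF_toForm_iff.1 (RC.inF h).1

theorem wlt.of_le {Λ μ ν : Ordinal.{0}} {A B : Worm} (h : wlt Λ ν B A) (hμ : μ ≤ ν) :
    wlt Λ μ B A := by
  rcases hμ.eq_or_lt with rfl | hμ
  · exact h
  · have hi := (RC.inF h).2
    exact .cut h (.dia_mono _ _ _ hi.1 hμ hi.2)

theorem wlt.trans {Λ μ : Ordinal.{0}} {A B C : Worm} (h : wlt Λ μ A B) (h' : wlt Λ μ B C) :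
    wlt Λ μ A C := by
  have hi := (RC.inF h).2
  exact .cut h' (.cut (.nec _ hi.1 h) (.dia_dia _ _ hi.1 hi.2))

theorem wlt_iff_weight_lt {Λ : Ordinal.{0}} {A B : Worm} (hA : IsNormalWorm A)
    (hB : IsNormalWorm B) (hAΛ : ∀ x ∈ A, x < Λ) (hBΛ : ∀ x ∈ B, x < Λ) :
    wlt Λ 0 A B ↔ weight 0 A < weight 0 B := by
  refine ⟨fun h => ?_, wlt_of_weight_lt hA hB hAΛ hBΛ (fun _ _ => bot_le) (fun _ _ => bot_le)⟩
  rcases lt_trichotomy (weight 0 A) (weight 0 B) with hlt | heq | hgt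
  · exact hlt
  · obtain rfl := hA.eq_of_weight_eq hB (fun _ _ => bot_le) (fun _ _ => bot_le) heq
    exact (not_wlt_self _ _ h).elim
  · exact (not_wlt_self _ _ (h.trans
      (wlt_of_weight_lt hB hA hBΛ hAΛ (fun _ _ => bot_le) (fun _ _ => bot_le) hgt))).elim

open Classical in
/-- The weight of a normal form of the worm `A`, or `0` if some modality of `A` is not below
`Λ`. -/
noncomputable def normalWeight (Λ : Ordinal.{0}) (A : Worm) : Ordinal.{0} :=
  if h : ∀ x ∈ A, x < Λ then weight 0 (exists_isNormalWorm_equiv h).choose else 0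

theorem wlt_iff_normalWeight_lt {Λ : Ordinal.{0}} {A B : Worm} (hA : ∀ x ∈ A, x < Λ)
    (hB : ∀ x ∈ B, x < Λ) : wlt Λ 0 A B ↔ normalWeight Λ A < normalWeight Λ B := by
  rw [normalWeight, normalWeight, dif_pos hA, dif_pos hB]
  obtain ⟨h1, h2, h3, h4⟩ := (exists_isNormalWorm_equiv hA).choose_spec
  obtain ⟨h5, h6, h7, h8⟩ := (exists_isNormalWorm_equiv hB).choose_spec
  rw [← wlt_iff_weight_lt h1 h5 h2 h6]
  constructor
  · intro h
    have hi := (RC.inF h).2.1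
    exact .cut h8 (.cut h (.nec _ hi h3))
  · intro h
    have hi := (RC.inF h).2.1
    exact .cut h7 (.cut h (.nec _ hi h4))

theorem normalWeight_of_isNormalWorm {Λ : Ordinal.{0}} {A : Worm} (h : IsNormalWorm A)
    (hA : ∀ x ∈ A, x < Λ) : normalWeight Λ A = weight 0 A := by
  rw [normalWeight, dif_pos hA]
  obtain ⟨h1, h2, h3, h4⟩ := (exists_isNormalWorm_equiv hA).choose_spec
  generalize (exists_isNormalWorm_equiv hA).choose = B at *
  rcases lt_trichotomy (weight 0 B) (weight 0 A) with hlt | heq | hgt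
  · rw [← wlt_iff_weight_lt h1 h h2 hA] at hlt
    exact (not_wlt_self _ _ (show wlt Λ 0 B B from .cut h4 hlt)).elim
  · exact heq
  · rw [← wlt_iff_weight_lt h h1 hA h2] at hgt
    exact (not_wlt_self _ _ (show wlt Λ 0 A A from .cut h3 hgt)).elim

theorem wellFounded_wlt (Λ : Ordinal.{0}) : WellFounded (wlt Λ 0) :=
  Subrelation.wf (fun {_ _} h => (wlt_iff_normalWeight_lt h.lt_left h.lt_right).1 h)
    (InvImage.wf (normalWeight Λ) wellFounded_lt)

theorem wormO_eq_iSup (Λ : Ordinal.{0}) (A : Worm) :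
    wormO Λ A = ⨆ B : {B : Worm // wlt Λ 0 B A}, (wormO Λ B.1 + 1) := by
  have h := wellFounded_wlt Λ
  have h1 : ∀ A, wormO Λ A = h.fix (C := fun _ => Ordinal.{0})
      (fun A o => ⨆ B : {B : Worm // wlt Λ 0 B A}, (o B.1 B.2 + 1)) A := fun A => by
    rw [wormO, dif_pos h]
  rw [h1, h.fix_eq]
  simp only [h1]

/-- Normal worms realise every weight below `Γ₀`, so the order type of a worm is the weight of its
normal form. -/
theorem wormO_eq_normalWeight {A : Worm} (hA : ∀ x ∈ A, x < Γ₀) :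
    wormO Γ₀ A = normalWeight Γ₀ A := by
  induction A using (wellFounded_wlt Γ₀).induction with
  | _ A ih =>
    have hle : ∀ B : {B : Worm // wlt Γ₀ 0 B A}, wormO Γ₀ B.1 + 1 ≤ normalWeight Γ₀ A := by
      rintro ⟨B, hB⟩
      rw [ih B hB hB.lt_left]
      exact Order.add_one_le_of_lt ((wlt_iff_normalWeight_lt hB.lt_left hB.lt_right).1 hB)
    rw [wormO_eq_iSup]
    apply le_antisymm
    · exact ciSup_le' hle
    · by_contra! hlt
      have hΓ : normalWeight Γ₀ A < Γ₀ := by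
        rw [normalWeight, dif_pos hA]
        exact weight_lt_gamma_zero (exists_isNormalWorm_equiv hA).choose_spec.2.1
      obtain ⟨B, h1, h2, h3⟩ := exists_isNormalWorm_weight_eq (hlt.trans hΓ)
      have hB := normalWeight_of_isNormalWorm h1 h2
      have hBA : wlt Γ₀ 0 B A := by
        rw [wlt_iff_normalWeight_lt h2 hA, hB, h3]
        exact hlt
      have h4 := le_ciSup (f := fun B : {B : Worm // wlt Γ₀ 0 B A} => wormO Γ₀ B.1 + 1)
        ⟨_, Set.forall_mem_range.2 hle⟩ ⟨B, hBA⟩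
      simp only at h4
      rw [ih B hBA h2, hB, h3] at h4
      exact (Order.lt_add_one_iff.2 le_rfl).not_ge h4

theorem wormO_of_isNormalWorm {A : Worm} (h : IsNormalWorm A) (hA : ∀ x ∈ A, x < Γ₀) :
    wormO Γ₀ A = weight 0 A := by
  rw [wormO_eq_normalWeight hA, normalWeight_of_isNormalWorm h hA]

theorem wormO_lt_gamma_zero {A : Worm} (hA : ∀ x ∈ A, x < Γ₀) : wormO Γ₀ A < Γ₀ := by
  rw [wormO_eq_normalWeight hA, normalWeight, dif_pos hA]
  exact weight_lt_gamma_zero (exists_isNormalWorm_equiv hA).choose_spec.2.1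

theorem wlt_iff_wormO_lt {A B : Worm} (hA : ∀ x ∈ A, x < Γ₀) (hB : ∀ x ∈ B, x < Γ₀) :
    wlt Γ₀ 0 A B ↔ wormO Γ₀ A < wormO Γ₀ B := by
  rw [wlt_iff_normalWeight_lt hA hB, wormO_eq_normalWeight hA, wormO_eq_normalWeight hB]

theorem wormO_le_of_rc {A B : Worm} (h : RC Γ₀ (Worm.toForm A) (Worm.toForm B)) :
    wormO Γ₀ B ≤ wormO Γ₀ A := by
  by_contra! hlt
  rw [← wlt_iff_wormO_lt (inF_toForm_iff.1 h.inF.1) (inF_toForm_iff.1 h.inF.2)] at hlt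
  exact not_wlt_self _ _ (show wlt Γ₀ 0 A A from .cut h hlt)

/-! ### Beklemishev normal forms are the normal worms -/

theorem weight_le_of_rc {Λ : Ordinal.{0}} {A B : Worm} (hA : IsNormalWorm A)
    (hB : IsNormalWorm B) (h : RC Λ (Worm.toForm A) (Worm.toForm B)) :
    weight 0 B ≤ weight 0 A := by
  by_contra! hlt
  rw [← wlt_iff_weight_lt (Λ := Λ) hA hB (inF_toForm_iff.1 h.inF.1)
    (inF_toForm_iff.1 h.inF.2)] at hlt
  exact not_wlt_self _ _ (show wlt Λ 0 A A from .cut h hlt)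

theorem wle_iff_weight_le {Λ μ : Ordinal.{0}} {A B : Worm} (hA : IsNormalWorm A)
    (hB : IsNormalWorm B) (hAΛ : ∀ x ∈ A, x < Λ) (hBΛ : ∀ x ∈ B, x < Λ)
    (hμA : ∀ x ∈ A, μ ≤ x) (hμB : ∀ x ∈ B, μ ≤ x) :
    wle Λ μ A B ↔ weight μ A ≤ weight μ B := by
  constructor
  · intro h
    rw [← not_lt, ← weight_lt_weight_iff (β := 0) bot_le hμB hμA, not_lt]
    rcases h with h | h
    · exact ((wlt_iff_weight_lt hA hB hAΛ hBΛ).1 (h.of_le bot_le)).le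
    · exact weight_le_of_rc hB hA h.2
  · intro h
    rcases h.lt_or_eq with h | h
    · exact Or.inl (wlt_of_weight_lt hA hB hAΛ hBΛ hμA hμB h)
    · obtain rfl := hA.eq_of_weight_eq hB hμA hμB h
      exact Or.inr ⟨.refl _ (inF_toForm_iff.2 hAΛ), .refl _ (inF_toForm_iff.2 hAΛ)⟩

theorem le_of_mem_joinBlocks {α : Ordinal.{0}} {A : ℕ → Worm} {k : ℕ}
    (h : ∀ i ≤ k, ∀ β ∈ A i, α + 1 ≤ β) : ∀ β ∈ joinBlocks α A k, α ≤ β := by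
  induction k with
  | zero => exact fun β hβ => (Order.add_one_le_iff.1 (h 0 le_rfl β hβ)).le
  | succ k ih =>
    intro β hβ
    rw [joinBlocks, List.mem_append, List.mem_cons] at hβ
    rcases hβ with hβ | rfl | hβ
    · exact (Order.add_one_le_iff.1 (h _ le_rfl β hβ)).le
    · exact le_rfl
    · exact ih (fun i hi => h i (hi.trans (Nat.le_succ k))) β hβ

theorem takeWhile_joinBlocks {α : Ordinal.{0}} {A : ℕ → Worm} {k : ℕ}
    (h : ∀ β ∈ A k, α + 1 ≤ β) : (joinBlocks α A k).takeWhile (α < ·) = A k := by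
  cases k with
  | zero => exact takeWhile_lt_eq_self fun β hβ => Order.add_one_le_iff.1 (h β hβ)
  | succ k => exact takeWhile_lt_append_cons fun β hβ => Order.add_one_le_iff.1 (h β hβ)

theorem joinBlocks_congr {α : Ordinal.{0}} {A B : ℕ → Worm} {k : ℕ} (h : ∀ i ≤ k, A i = B i) :
    joinBlocks α A k = joinBlocks α B k := by
  induction k with
  | zero => exact h 0 le_rfl
  | succ k ih =>
    rw [joinBlocks, joinBlocks, h _ le_rfl, ih fun i hi => h i (hi.trans (Nat.le_succ k))]

theorem BNF.isNormalWorm {Λ : Ordinal.{0}} {A : Worm} (h : BNF Λ A) :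
    IsNormalWorm A ∧ ∀ x ∈ A, x < Λ := by
  induction h with
  | top => exact ⟨.nil, by simp⟩
  | blocks α A k hα _ hge _ hle ih =>
    suffices ∀ j ≤ k, IsNormalWorm (joinBlocks α A j) ∧ ∀ x ∈ joinBlocks α A j, x < Λ from
      this k le_rfl
    intro j hj
    induction j with
    | zero => exact ih 0 hj
    | succ j ihj =>
      obtain ⟨h1, h2⟩ := ihj (Nat.le_of_succ_le hj)
      obtain ⟨h3, h4⟩ := ih (j + 1) hj
      obtain ⟨h5, h6⟩ := ih j (Nat.le_of_succ_le hj)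
      have hgj := hge j (Nat.le_of_succ_le hj)
      constructor
      · refine .append (fun x hx => Order.add_one_le_iff.1 (hge _ hj x hx))
          (le_of_mem_joinBlocks fun i hi => hge i (hi.trans (Nat.le_of_succ_le hj))) h3 h1 ?_
        rw [takeWhile_joinBlocks hgj]
        exact (wle_iff_weight_le h3 h5 h4 h6 (hge _ hj) hgj).1 (hle j hj)
      · rw [joinBlocks]
        simp only [List.mem_append, List.mem_cons]
        rintro x (hx | rfl | hx)
        exacts [h4 x hx, hα, h2 x hx]

theorem IsNormalWorm.bnf {Λ : Ordinal.{0}} {A : Worm} (h : IsNormalWorm A) (hA : ∀ x ∈ A, x < Λ) :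
    BNF Λ A := by
  induction h with
  | nil => exact .top
  | @append C X α h1 h2 h3 h4 h5 ih1 ih2 =>
    simp only [List.mem_append, List.mem_cons, or_imp, forall_and, forall_eq] at hA
    obtain ⟨hCΛ, hα, hXΛ⟩ := hA
    have hC := ih1 hCΛ
    have hX := ih2 hXΛ
    have h1' : ∀ x ∈ C, α + 1 ≤ x := fun x hx => Order.add_one_le_of_lt (h1 x hx)
    clear ih1 ih2
    rcases forall_lt_or_splits h2 with hlt | ⟨D, Y, hs⟩
    · have h2' : ∀ x ∈ X, α + 1 ≤ x := fun x hx => Order.add_one_le_of_lt (hlt x hx)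
      rw [takeWhile_lt_eq_self hlt] at h5
      refine BNF.blocks α (fun i => if i = 0 then X else C) 1 hα le_rfl ?_ ?_ ?_
      · intro i _
        split_ifs
        exacts [h2', h1']
      · intro i _
        split_ifs
        exacts [hX, hC]
      · intro i hi
        obtain rfl : i = 0 := by omega
        exact (wle_iff_weight_le h3 h4 hCΛ hXΛ h1' h2').2 h5
    · cases hX with
      | top => simpa using hs.eq
      | blocks β A k hβ hk hge hA hle =>
        have hβX : β ∈ joinBlocks β A k := by
          obtain ⟨k, rfl⟩ := Nat.exists_eq_add_of_le' hk
          simp [joinBlocks]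
        obtain rfl : β = α := le_antisymm (le_of_mem_joinBlocks hge α hs.mem) (h2 β hβX)
        rw [takeWhile_joinBlocks (hge k le_rfl)] at h5
        have hAk := (hA k le_rfl).isNormalWorm
        have key := BNF.blocks (Λ := Λ) β (fun i => if i ≤ k then A i else C) (k + 1) hα
          (Nat.succ_pos k) ?_ ?_ ?_
        · rw [joinBlocks, joinBlocks_congr (B := A) (fun i hi => if_pos hi),
            if_neg (Nat.not_succ_le_self k)] at key
          exact key
        · intro i _
          split_ifs with hi
          exacts [hge i hi, h1']
        · intro i _
          split_ifs with hi
          exacts [hA i hi, hC]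
        · intro i hi
          rw [if_pos (Nat.le_of_lt_succ hi)]
          split_ifs with hi'
          · exact hle i hi'
          · obtain rfl : i = k := by omega
            exact (wle_iff_weight_le h3 hAk.1 hCΛ hAk.2 h1' (hge i le_rfl)).2 h5

theorem wlt_cons {Λ : Ordinal.{0}} {α : Ordinal.{0}} {A : Worm} (h : ∀ x ∈ α :: A, x < Λ) :
    wlt Λ 0 A (α :: A) :=
  wlt.of_le (.refl _ (inF_toForm_iff.2 h) : wlt Λ α A (α :: A)) bot_le

theorem IsNormalWorm.tail {Λ : Ordinal.{0}} {A : Worm} (h : IsNormalWorm A)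
    (hA : ∀ x ∈ A, x < Λ) : IsNormalWorm A.tail := by
  induction h with
  | nil => exact .nil
  | @append C X α h1 h2 h3 h4 h5 ih1 _ =>
    simp only [List.mem_append, List.mem_cons, or_imp, forall_and, forall_eq] at hA
    cases C with
    | nil => exact h4
    | cons c C =>
      have hC : IsNormalWorm C := ih1 hA.1
      refine .append (fun x hx => h1 x (by simp [hx])) h2 hC h4 (le_trans (le_of_lt ?_) h5)
      rw [← weight_lt_weight_iff (β := 0) bot_le
        (fun x hx => Order.add_one_le_of_lt (h1 x (by simp [hx])))
        (fun x hx => Order.add_one_le_of_lt (h1 x hx)),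
        ← wlt_iff_weight_lt hC h3 (fun x hx => hA.1 x (by simp [hx])) hA.1]
      exact wlt_cons hA.1

theorem lt_wormO_of_mem {A : Worm} (hA : ∀ x ∈ A, x < Γ₀) : ∀ x ∈ A, x < wormO Γ₀ A := by
  induction A with
  | nil => simp
  | cons α A ih =>
    have hA' := List.forall_mem_cons.1 hA
    refine List.forall_mem_cons.2 ⟨?_, fun x hx => ?_⟩
    · have h1 : IsNormalWorm [α] := .append (C := []) (by simp) (by simp) .nil .nil (by simp)
      have h2 : Splits [α] [] α [] := ⟨rfl, by simp, by simp⟩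
      calc α < hyperexp α 1 := lt_hyperexp_one hA'.1
        _ = wormO Γ₀ [α] := by
          rw [wormO_of_isNormalWorm h1 (by simpa using hA'.1), h2.weight_eq]
          simp
        _ ≤ wormO Γ₀ (α :: A) :=
          wormO_le_of_rc (.nec α hA'.1 (.top _ (inF_toForm_iff.2 hA'.2)))
    · exact (ih hA'.2 x hx).trans ((wlt_iff_wormO_lt hA'.2 hA).1 (wlt_cons hA))

/-! ### Soundness of the bracket calculus -/

theorem BWorm.star_lt (a : BWorm) : ∀ x ∈ a.star, x < Γ₀ := by
  induction a with
  | top => simp [BWorm.star]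
  | br a b ih1 ih2 => exact List.forall_mem_cons.2 ⟨wormO_lt_gamma_zero ih1, ih2⟩

theorem BWorm.ostar_lt (a : BWorm) : a.ostar < Γ₀ := wormO_lt_gamma_zero a.star_lt

/-- The translation of formulas of the bracket calculus that replaces each modality `(a)` by
`⟨o*(a)⟩`. -/
noncomputable def BForm.toRC : BForm → RCForm
  | .top => .top
  | .var n => .var n
  | .and φ ψ => .and φ.toRC ψ.toRC
  | .br a φ => .dia a.ostar φ.toRC

theorem BForm.inF_toRC (φ : BForm) : φ.toRC.InF Γ₀ := by
  induction φ with
  | top => trivial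
  | var n => trivial
  | and φ ψ ih1 ih2 => exact ⟨ih1, ih2⟩
  | br a φ ih => exact ⟨a.ostar_lt, ih⟩

theorem BWorm.toRC_toForm (a : BWorm) : a.toForm.toRC = Worm.toForm a.star := by
  induction a with
  | top => rfl
  | br a b _ ih => exact congrArg (RCForm.dia _) ih

theorem BWorm.ostar_top : BWorm.top.ostar = 0 :=
  (wormO_of_isNormalWorm .nil (by simp)).trans (weight_nil 0)

theorem BWorm.ostar_lt_of_rc {a b : BWorm}
    (h : RC Γ₀ a.toForm.toRC (BForm.br .top b.toForm).toRC) : b.ostar < a.ostar := by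
  rw [BForm.toRC, BWorm.ostar_top, BWorm.toRC_toForm, BWorm.toRC_toForm] at h
  exact (wlt_iff_wormO_lt b.star_lt a.star_lt).1 h

theorem BWorm.ostar_le_of_rc {a b : BWorm} (h : RC Γ₀ a.toForm.toRC b.toForm.toRC) :
    b.ostar ≤ a.ostar := by
  rw [BWorm.toRC_toForm, BWorm.toRC_toForm] at h
  exact wormO_le_of_rc h

theorem rc_dia_dia {Λ α β : Ordinal.{0}} {φ ψ : RCForm} (hα : α < Λ) (hβ : β ≤ α)
    (h : RC Λ φ ψ) : RC Λ (.dia α φ) (.dia β ψ) := by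
  have h1 : RC Λ (.dia α φ) (.dia α ψ) := .nec α hα h
  rcases hβ.eq_or_lt with rfl | hβ
  · exact h1
  · exact .cut h1 (.dia_mono _ _ _ hα hβ h.inF.2)

theorem rc_dia_dia_dia {Λ α β : Ordinal.{0}} {φ ψ : RCForm} (hα : α < Λ) (hβ : β ≤ α)
    (h : RC Λ φ ψ) : RC Λ (.dia α (.dia β φ)) (.dia β ψ) := by
  have hβΛ := hβ.trans_lt hα
  have h1 : RC Λ (.dia β φ) (.dia β ψ) := .nec β hβΛ h
  exact .cut (rc_dia_dia hα hβ h1) (.dia_dia _ _ hβΛ h.inF.2)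

theorem BC.toRC {φ ψ : BForm} (h : BC φ ψ) : RC Γ₀ φ.toRC ψ.toRC := by
  induction h with
  | refl φ => exact .refl _ φ.inF_toRC
  | top φ => exact .top _ φ.inF_toRC
  | and_left φ ψ => exact .and_left _ _ φ.inF_toRC ψ.inF_toRC
  | and_right φ ψ => exact .and_right _ _ φ.inF_toRC ψ.inF_toRC
  | and_intro _ _ ih1 ih2 => exact .and_intro ih1 ih2
  | cut _ _ ih1 ih2 => exact .cut ih1 ih2
  | @br_lt _ _ a _ _ _ ih1 ih2 => exact rc_dia_dia a.ostar_lt (BWorm.ostar_lt_of_rc ih2).le ih1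
  | @br_imp _ _ a _ _ _ ih1 ih2 => exact rc_dia_dia a.ostar_lt (BWorm.ostar_le_of_rc ih2) ih1
  | @br_br_lt _ _ a _ _ _ ih1 ih2 =>
    exact rc_dia_dia_dia a.ostar_lt (BWorm.ostar_lt_of_rc ih2).le ih1
  | @br_br_imp _ _ a _ _ _ ih1 ih2 =>
    exact rc_dia_dia_dia a.ostar_lt (BWorm.ostar_le_of_rc ih2) ih1
  | @br_and φ ψ a b _ ih =>
    exact .dia_and _ _ _ _ a.ostar_lt (BWorm.ostar_lt_of_rc ih) φ.inF_toRC ψ.inF_toRC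

theorem BWorm.le.ostar_le {a b : BWorm} (h : BWorm.le a b) : a.ostar ≤ b.ostar :=
  h.elim (fun h => (BWorm.ostar_lt_of_rc h.toRC).le) fun h => BWorm.ostar_le_of_rc h.toRC

/-! ### Completeness of the bracket calculus on normal forms -/

/-- The bracket calculus as a worm system, with `b ◁ a` as the comparison of modalities. -/
def bcSystem : WormSystem BWorm BForm where
  top := .top
  and := .and
  dia := .br
  le := BC
  lt b a := BC a.toForm (.br .top b.toForm)
  refl := .refl
  trans := .cut
  le_top := .top
  and_left := .and_left
  and_right := .and_right
  le_and := .and_intro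
  dia_mono _ _ _ h := .br_imp h (.refl _)
  dia_anti φ h := .br_lt (.refl φ) h
  dia_dia _ φ := .br_br_imp (.refl φ) (.refl _)
  dia_and φ ψ h := .br_and φ ψ h

/-- The list of modalities of a bracket worm. -/
def BWorm.toList : BWorm → List BWorm
  | .top => []
  | .br a b => a :: b.toList

theorem BWorm.toList_injective : Function.Injective BWorm.toList := by
  intro a
  induction a with
  | top => intro b h; cases b <;> simp_all [BWorm.toList]
  | br a a' _ ih =>
    intro b h
    cases b with
    | top => simp [BWorm.toList] at h
    | br b b' =>
      simp only [BWorm.toList, List.cons.injEq] at h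
      rw [h.1, ih h.2]

theorem BWorm.form_toList (a : BWorm) : bcSystem.form a.toList = a.toForm := by
  induction a with
  | top => rfl
  | br a b _ ih => exact congrArg (BForm.br a) ih

theorem BWorm.map_toList (a : BWorm) : a.toList.map BWorm.ostar = a.star := by
  induction a with
  | top => rfl
  | br a b _ ih => exact congrArg (_ :: ·) ih

/-- The nesting depth of a bracket worm. -/
def BWorm.depth : BWorm → ℕ
  | .top => 0
  | .br a b => max (a.depth + 1) b.depth

theorem BWorm.depth_lt_of_mem {a x : BWorm} (h : x ∈ a.toList) : x.depth < a.depth := by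
  induction a with
  | top => simp [BWorm.toList] at h
  | br a b _ ih =>
    rcases List.mem_cons.1 h with rfl | h
    · exact lt_max_of_lt_left (Nat.lt_succ_self _)
    · exact lt_max_of_lt_right (ih h)

theorem NF.of_mem {a x : BWorm} (h : NF a) (hx : x ∈ a.toList) : NF x := by
  induction h with
  | top => simp [BWorm.toList] at hx
  | br h1 _ _ _ ih =>
    rcases List.mem_cons.1 hx with rfl | hx
    exacts [h1, ih hx]

theorem NF.isNormalWorm {a : BWorm} (h : NF a) : IsNormalWorm (a.toList.map BWorm.ostar) := by
  rw [BWorm.map_toList]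
  cases h with
  | top => exact .nil
  | br _ _ h => exact h.isNormalWorm.1

theorem NF.ostar_eq {a : BWorm} (h : NF a) :
    a.ostar = weight 0 (a.toList.map BWorm.ostar) := by
  have := h.isNormalWorm
  rw [BWorm.map_toList] at *
  exact wormO_of_isNormalWorm this a.star_lt

/-- Normal forms are determined by their ordinals, and the bracket calculus derives the comparison
of normal forms with different ordinals. By induction on the depth, this is known for the modalities
of the two normal forms, and these are then compared like normal worms. -/
theorem NF.eq_and_lt {a b : BWorm} (ha : NF a) (hb : NF b) :
    (a.ostar = b.ostar → a = b) ∧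
      (a.ostar < b.ostar → BC b.toForm (.br .top a.toForm)) := by
  suffices H : ∀ n, ∀ a b : BWorm, NF a → NF b → a.depth < n → b.depth < n →
      (a.ostar = b.ostar → a = b) ∧
        (a.ostar < b.ostar → BC b.toForm (.br .top a.toForm)) from
    H (max a.depth b.depth + 1) a b ha hb (by omega) (by omega)
  clear ha hb a b
  intro n
  induction n with
  | zero => intro a b _ _ h; omega
  | succ n ih =>
    intro a b ha hb hda hdb
    let P : Set BWorm := {x | NF x ∧ x.depth < n}
    have haP : ∀ x ∈ a.toList, x ∈ P := fun x hx =>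
      ⟨ha.of_mem hx, by have := BWorm.depth_lt_of_mem hx; omega⟩
    have hbP : ∀ x ∈ b.toList, x ∈ P := fun x hx =>
      ⟨hb.of_mem hx, by have := BWorm.depth_lt_of_mem hx; omega⟩
    have hinj : Set.InjOn BWorm.ostar P := fun x hx y hy => (ih x y hx.1 hy.1 hx.2 hy.2).1
    rw [ha.ostar_eq, hb.ostar_eq]
    constructor
    · intro h
      exact BWorm.toList_injective (eq_of_map_eq hinj haP hbP
        (ha.isNormalWorm.eq_of_weight_eq hb.isNormalWorm (fun _ _ => bot_le)
          (fun _ _ => bot_le) h))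
    · intro h
      have htop : BWorm.top ∈ P := by
        obtain ⟨x, hx⟩ : ∃ x, x ∈ b.toList :=
          List.exists_mem_of_ne_nil _ (by intro h0; simp [h0] at h)
        exact ⟨.top, (Nat.zero_le _).trans_lt (hbP x hx).2⟩
      have h0 : ∀ x : BWorm, BWorm.top.ostar ≤ x.ostar := fun x => by
        rw [BWorm.ostar_top]
        exact bot_le
      have key := bcSystem.form_le_dia_form BWorm.ostar P
        (fun x hx y hy => (ih x y hx.1 hy.1 hx.2 hy.2).2) hinj haP hbP ha.isNormalWorm
        hb.isNormalWorm (fun _ _ => bot_le) (fun _ _ => bot_le) h htop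
        (fun x _ => h0 x) (fun x _ => h0 x)
      rwa [BWorm.form_toList, BWorm.form_toList] at key

theorem NF.le_iff {a b : BWorm} (ha : NF a) (hb : NF b) :
    BWorm.le a b ↔ a.ostar ≤ b.ostar := by
  refine ⟨BWorm.le.ostar_le, fun h => ?_⟩
  rcases h.lt_or_eq with h | h
  · exact Or.inl ((ha.eq_and_lt hb).2 h)
  · rw [(ha.eq_and_lt hb).1 h]
    exact Or.inr (.refl _)

/-! ### Every ordinal below `Γ₀` is denoted by a normal form -/

theorem exists_nf_star_eq {A : Worm} (h : IsNormalWorm A) (hA : ∀ ξ ∈ A, ∃ c, NF c ∧ c.ostar = ξ) :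
    ∃ a, NF a ∧ a.star = A := by
  have hΓ : ∀ ξ ∈ A, ξ < Γ₀ := fun ξ hξ => by
    obtain ⟨c, -, rfl⟩ := hA ξ hξ
    exact c.ostar_lt
  induction A with
  | nil => exact ⟨.top, .top, rfl⟩
  | cons α A ih =>
    have hA' := List.forall_mem_cons.1 hA
    obtain ⟨c, hc, rfl⟩ := hA'.1
    obtain ⟨b, hb, rfl⟩ := ih (h.tail hΓ) hA'.2 (List.forall_mem_cons.1 hΓ).2
    exact ⟨.br c b, .br hc hb (h.bnf hΓ), rfl⟩

/-- Modalities of a worm are smaller than its order type, so that the normal forms denoting them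
are available by induction. -/
theorem exists_nf_ostar_eq {x : Ordinal.{0}} (hx : x < Γ₀) : ∃ a, NF a ∧ a.ostar = x := by
  induction x using WellFoundedLT.induction with
  | ind x ih =>
    obtain ⟨A, h1, h2, h3⟩ := exists_isNormalWorm_weight_eq hx
    rw [← wormO_of_isNormalWorm h1 h2] at h3
    obtain ⟨a, ha, rfl⟩ := exists_nf_star_eq h1 fun ξ hξ =>
      ih ξ (h3 ▸ lt_wormO_of_mem h2 ξ hξ) (h2 ξ hξ)
    exact ⟨a, ha, h3⟩

theorem bijOn_ostar : Set.BijOn BWorm.ostar {a | NF a} (Set.Iio Γ₀) :=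
  ⟨fun a _ => a.ostar_lt, fun _ ha _ hb h => (NF.eq_and_lt ha hb).1 h,
    fun _ hx => exists_nf_ostar_eq hx⟩

theorem strictPart_nfLE_iff {a b : {a : BWorm // NF a}} :
    strictPart nfLE a b ↔ a.1.ostar < b.1.ostar := by
  rw [strictPart, nfLE, nfLE, a.2.le_iff b.2, b.2.le_iff a.2, not_le]
  exact ⟨fun h => h.2, fun h => ⟨h.le, h⟩⟩

theorem isWellOrderLE_nfLE : IsWellOrderLE nfLE where
  refl a := (a.2.le_iff a.2).2 le_rfl
  trans a b c h h' := (a.2.le_iff c.2).2 (((a.2.le_iff b.2).1 h).trans ((b.2.le_iff c.2).1 h'))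
  total a b := (le_total a.1.ostar b.1.ostar).imp (a.2.le_iff b.2).2 (b.2.le_iff a.2).2
  antisymm a b h h' := Subtype.ext
    ((a.2.eq_and_lt b.2).1 (((a.2.le_iff b.2).1 h).antisymm ((b.2.le_iff a.2).1 h')))
  exists_least S hS := by
    obtain ⟨m, hm, hmin⟩ := (InvImage.wf (fun a : {a : BWorm // NF a} => a.1.ostar)
      (wellFounded_lt (α := Ordinal.{0}))).has_min S hS
    exact ⟨m, hm, fun b hb => (m.2.le_iff b.2).2 (not_lt.1 (hmin b hb))⟩

/-- The normal forms, ordered by the strict part of `⊴`, are isomorphic to `Γ₀`. -/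
noncomputable def nfRelIso :
    strictPart nfLE ≃r ((· < ·) : Ordinal.ToType Γ₀ → Ordinal.ToType Γ₀ → Prop) where
  toEquiv := (bijOn_ostar.equiv BWorm.ostar).trans ToType.mk.toEquiv
  map_rel_iff' {a b} := by
    refine Iff.trans ?_ strictPart_nfLE_iff.symm
    exact ToType.mk.lt_iff_lt

end BracketCalculus

theorem mainTheorem2 :
    -- the relation on normal forms is a linear well-order
    BracketCalculus.IsWellOrderLE BracketCalculus.nfLE ∧
    -- its order type is the Feferman–Schütte ordinal
    (∃ _ : IsWellOrder {a : BracketCalculus.BWorm // BracketCalculus.NF a}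
        (BracketCalculus.strictPart BracketCalculus.nfLE),
      Ordinal.type (BracketCalculus.strictPart BracketCalculus.nfLE) = Γ₀) ∧
    -- the normal forms are a notation system: every ordinal below `Γ₀` is denoted by exactly
    -- one normal form, and `⊴` compares the denoted ordinals
    Set.BijOn BracketCalculus.BWorm.ostar {a | BracketCalculus.NF a} (Set.Iio Γ₀) ∧
    (∀ a b : BracketCalculus.BWorm, BracketCalculus.NF a → BracketCalculus.NF b →
      (BracketCalculus.BWorm.le a b ↔
        BracketCalculus.BWorm.ostar a ≤ BracketCalculus.BWorm.ostar b)) := by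
  refine ⟨BracketCalculus.isWellOrderLE_nfLE, ?_, BracketCalculus.bijOn_ostar,
    fun a b ha hb => ha.le_iff hb⟩
  have hwo := BracketCalculus.nfRelIso.toRelEmbedding.isWellOrder
  refine ⟨hwo, ?_⟩
  rw [BracketCalculus.nfRelIso.ordinalType_congr, Ordinal.type_toType]
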